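/- Corollary (large discrepancy). Let $b\ge 2$ be an integer. Identify a real number $x\in[0,1)$ with its base-$b$ expansion $x_1x_2x_3\ldots$, where $x_j\in\{0,\ldots,b-1\}$, $x=\sum_{j\ge1}x_jb^{-j}$ and $x_j\neq0$ for infinitely many $j$ (the number $0$, which has no such expansion, is left out of all the sets below). For a real $r\ge 0$ let $x\restriction r$ be the initial segment $x_1\ldots x_{\lfloor r\rfloor}$, and for words $u,w$ over $\{0,\ldots,b-1\}$ let $W(u,w)$ be the number of (possibly overlapping) occurrences of $w$ in $u$. The number $x$ is *Poisson generic* in base $b$ if for every real $\lambda>0$ and every integer $j\ge0$, $$\lim_{k\to\infty}\frac1{b^k}\bigl|\{w\in\{0,\ldots,b-1\}^k : W(x\restriction(\lambda b^k+k),w)=j\}\bigr|=e^{-\lambda}\frac{\lambda^j}{j!}.$$ It is *(Borel) normal* in base $b$ if $\lim_{n\to\infty}W(x\restriction n,w)/n=b^{-|w|}$ for every word $w$. Given a function $f$ that assigns a real number $f(w,n)$ to each word $w$ over $\{0,\ldots,b-1\}$ and each integer $n\ge1$, the number $x$ (or its digit sequence) has *$f$-large discrepancy* if $$\Bigl|\frac{n}{b^{|w|}}-W(x\restriction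 n,w)\Bigr|>f(w,n)\qquad\text{for all words } w \text{ and all } n\ge1.$$ Then for every such function $f$ (in particular for every $f$ with positive values), the set of digit sequences in $\{0,\ldots,b-1\}^{\mathbb N}$ (product of discrete topologies) with $f$-large discrepancy is closed, and the set of $x\in[0,1)$ that are Poisson generic in base $b$ is not equal to the set of $x\in[0,1)$ that are normal in base $b$ and have $f$-large discrepancy. -/

import Mathlib

open Filter Topology

noncomputable section

namespace PoissonGeneric

/-- `d` is the base-`b` expansion of the real number `x`: the digit `d j` stands at position
`j + 1` (positions are counted from `1` in the usual notation `x = 0.x₁x₂x₃…`), and infinitely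
many digits are nonzero. This convention makes the expansion unique. -/
def IsExpansion (b : ℕ) (x : ℝ) (d : ℕ → Fin b) : Prop :=
  HasSum (fun j : ℕ => ((d j : ℕ) : ℝ) / (b : ℝ) ^ (j + 1)) x ∧
    {j : ℕ | (d j : ℕ) ≠ 0}.Infinite

/-- `W(d ↾ n, w)`: the number of (possibly overlapping) occurrences of the word `w` of length `k`
in the initial segment consisting of the first `n` digits of `d`. -/
def W {b : ℕ} (d : ℕ → Fin b) (n : ℕ) {k : ℕ} (w : Fin k → Fin b) : ℕ :=
  ((Finset.range (n + 1)).filter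
    (fun i : ℕ => i + k ≤ n ∧ ∀ t : Fin k, d (i + t) = w t)).card

/-- `Z^lam_{j,k}`: the proportion of words of length `k` that occur exactly `j` times among the
first `⌊lam * b ^ k + k⌋` digits of `d`. -/
def Z {b : ℕ} (d : ℕ → Fin b) (lam : ℝ) (j k : ℕ) : ℝ :=
  (1 / (b : ℝ) ^ k) *
    ((Finset.univ.filter
      (fun w : Fin k → Fin b => W d ⌊lam * (b : ℝ) ^ k + (k : ℝ)⌋₊ w = j)).card : ℝ)

/-- `d` is `lam`-Poisson generic. -/
def IsLambdaPoissonGeneric {b : ℕ} (d : ℕ → Fin b) (lam : ℝ) : Prop :=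
  ∀ j : ℕ, Tendsto (fun k : ℕ => Z d lam j k) atTop
    (𝓝 (Real.exp (-lam) * (lam ^ j / (Nat.factorial j : ℝ))))

/-- `d` is Borel normal. -/
def IsNormal {b : ℕ} (d : ℕ → Fin b) : Prop :=
  ∀ (k : ℕ) (w : Fin k → Fin b),
    Tendsto (fun n : ℕ => (W d n w : ℝ) / (n : ℝ)) atTop (𝓝 (1 / (b : ℝ) ^ k))

/-- The `(w, n)`-discrepancy `|n / b ^ |w| - W(d ↾ n, w)|`. -/
def discrepancy {b : ℕ} (d : ℕ → Fin b) {k : ℕ} (w : Fin k → Fin b) (n : ℕ) : ℝ :=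
  |(n : ℝ) / (b : ℝ) ^ k - (W d n w : ℝ)|

/-- `d` has `f`-large discrepancy. -/
def HasLargeDiscrepancy {b : ℕ} (f : (k : ℕ) → (Fin k → Fin b) → ℕ → ℝ) (d : ℕ → Fin b) : Prop :=
  ∀ (k : ℕ) (w : Fin k → Fin b) (n : ℕ), 0 < n → f k w n < discrepancy d w n

/-- The set of real numbers in `[0, 1)` that are Poisson generic in base `b`. -/
def poissonGenericReals (b : ℕ) : Set ℝ :=
  {x | x ∈ Set.Ico (0 : ℝ) 1 ∧ ∃ d : ℕ → Fin b, IsExpansion b x d ∧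
    ∀ lam : ℝ, 0 < lam → IsLambdaPoissonGeneric d lam}

/-- The set of real numbers in `[0, 1)` that are Borel normal in base `b`. -/
def normalReals (b : ℕ) : Set ℝ :=
  {x | x ∈ Set.Ico (0 : ℝ) 1 ∧ ∃ d : ℕ → Fin b, IsExpansion b x d ∧ IsNormal d}

/-- The set of real numbers in `[0, 1)` that have base-`b` `f`-large discrepancy. -/
def largeDiscrepancyReals (b : ℕ) (f : (k : ℕ) → (Fin k → Fin b) → ℕ → ℝ) : Set ℝ :=
  {x | x ∈ Set.Ico (0 : ℝ) 1 ∧ ∃ d : ℕ → Fin b, IsExpansion b x d ∧ HasLargeDiscrepancy f d}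

end PoissonGeneric

end

/-! The argument is topological. For fixed `w` and `n` the discrepancy depends on finitely many
digits, so large discrepancy is an intersection of clopen conditions, hence closed. Poisson
genericity and normality, by contrast, are unaffected by changing finitely many digits. Suppose the
two sets of reals coincide, and let `p` be Poisson generic and normal. Every sequence that agrees
with `p` from some point on is again generic, so it has large discrepancy. Such sequences are dense,
so by closedness every sequence has large discrepancy. The condition on `f` is then vacuous, and
normality would imply Poisson genericity. A normal sequence that is not Poisson generic gives the
contradiction.

The sequence `p` comes from a probabilistic argument without measure theory. Averaging over finitely
many digits plays the role of expectation. The expected proportions follow an Euler scheme for the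
Poisson equations `p_j' = p_(j-1) - p_j` (`abs_expect_hitProportion_sub_poissonWeight_le`). Bounded
differences make the variances summable (`expect_variance_le`), and compactness of the sequence
space replaces the Borel-Cantelli lemma (`exists_forall_sum_le`).

The counterexample `sparseZeros` overwrites digits of `p` by zeros on a set of density zero, so
normality survives. Yet inside a long word the zeros are forced often enough that few words of that
length occur: the proportion of absent words is asymptotically at least `1 - 1/b ≥ 1/2`, above the
Poisson value `exp (-1)` (`not_isLambdaPoissonGeneric_sparseZeros`). -/

namespace PoissonGeneric

/-! ### Expectation over finitely many digits, variance bounds and compactness -/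

section Averaging

/-- The average of `F` over all values of the digit at position `i`. -/
noncomputable def digitAverage {b : ℕ} (i : ℕ) (F : (ℕ → Fin b) → ℝ) (d : ℕ → Fin b) : ℝ :=
  (∑ a : Fin b, F (Function.update d i a)) / b

/-- The expectation of `F` when the first `M` digits are independent and uniformly distributed
and the other digits vanish. -/
noncomputable def expect {b : ℕ} [NeZero b] : ℕ → ((ℕ → Fin b) → ℝ) → ℝ
  | 0, F => F 0
  | M + 1, F => expect M (digitAverage M F)

variable {b : ℕ}

theorem digitAverage_add (i : ℕ) (F G : (ℕ → Fin b) → ℝ) :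
    digitAverage i (fun d => F d + G d) = fun d => digitAverage i F d + digitAverage i G d := by
  funext d
  simp [digitAverage, Finset.sum_add_distrib, add_div]

theorem digitAverage_const_mul (i : ℕ) (c : ℝ) (F : (ℕ → Fin b) → ℝ) :
    digitAverage i (fun d => c * F d) = fun d => c * digitAverage i F d := by
  funext d
  simp [digitAverage, ← Finset.mul_sum, mul_div_assoc]

theorem digitAverage_mono (i : ℕ) {F G : (ℕ → Fin b) → ℝ} (h : ∀ d, F d ≤ G d) (d : ℕ → Fin b) :
    digitAverage i F d ≤ digitAverage i G d := by
  unfold digitAverage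
  gcongr
  exact h _

theorem dependsOn_update {F : (ℕ → Fin b) → ℝ} {n i : ℕ} (hF : DependsOn F (Set.Iio n))
    (hi : n ≤ i) (d : ℕ → Fin b) (a : Fin b) : F (Function.update d i a) = F d := by
  apply hF
  intro j hj
  have : j < n := hj
  exact Function.update_of_ne (by omega) _ _

theorem isLocallyConstant_of_dependsOn {α : Type*} {F : (ℕ → Fin b) → α} {n : ℕ}
    (hF : DependsOn F (Set.Iio n)) : IsLocallyConstant F := by
  rw [IsLocallyConstant.iff_eventually_eq]
  intro d
  have h : ∀ᶠ e : ℕ → Fin b in 𝓝 d, ∀ i ∈ Set.Iio n, e i = d i := by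
    rw [(Set.finite_Iio n).eventually_all]
    intro i _
    exact ((continuous_apply i).tendsto d).eventually (p := fun x => x = d i) (by simp [nhds_discrete])
  filter_upwards [h] with e he
  exact hF he

variable [NeZero b]

theorem digitAverage_of_update {i : ℕ} {F : (ℕ → Fin b) → ℝ}
    (h : ∀ d a, F (Function.update d i a) = F d) : digitAverage i F = F := by
  funext d
  have : (b : ℝ) ≠ 0 := by exact_mod_cast NeZero.ne b
  simp [digitAverage, h]
  field_simp

theorem expect_add (M : ℕ) : ∀ F G : (ℕ → Fin b) → ℝ,
    expect M (fun d => F d + G d) = expect M F + expect M G := by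
  induction M with
  | zero => intro F G; rfl
  | succ M ih => intro F G; simp only [expect, digitAverage_add, ih]

theorem expect_const_mul (M : ℕ) (c : ℝ) : ∀ F : (ℕ → Fin b) → ℝ,
    expect M (fun d => c * F d) = c * expect M F := by
  induction M with
  | zero => intro F; rfl
  | succ M ih => intro F; simp only [expect, digitAverage_const_mul, ih]

theorem expect_mono (M : ℕ) : ∀ {F G : (ℕ → Fin b) → ℝ}, (∀ d, F d ≤ G d) →
    expect M F ≤ expect M G := by
  induction M with
  | zero => intro F G h; exact h _
  | succ M ih => intro F G h; exact ih (digitAverage_mono M h)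

theorem expect_const (M : ℕ) (c : ℝ) : expect M (fun _ : ℕ → Fin b => c) = c := by
  induction M with
  | zero => rfl
  | succ M ih =>
    rw [expect, digitAverage_of_update (fun _ _ => rfl), ih]

theorem expect_sub (M : ℕ) (F G : (ℕ → Fin b) → ℝ) :
    expect M (fun d => F d - G d) = expect M F - expect M G := by
  have h := expect_add M F (fun d => (-1) * G d)
  rw [expect_const_mul] at h
  simpa [sub_eq_add_neg] using h

theorem expect_sum {ι : Type*} (M : ℕ) (s : Finset ι) (F : ι → (ℕ → Fin b) → ℝ) :
    expect M (fun d => ∑ i ∈ s, F i d) = ∑ i ∈ s, expect M (F i) := by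
  classical
  induction s using Finset.induction_on with
  | empty => simpa using expect_const M (0 : ℝ)
  | insert a s ha ih => simp only [Finset.sum_insert ha, expect_add, ih]

theorem abs_expect_sub_le (M : ℕ) {F G K : (ℕ → Fin b) → ℝ} (h : ∀ d, |F d - G d| ≤ K d) :
    |expect M F - expect M G| ≤ expect M K := by
  rw [← expect_sub, abs_le]
  constructor
  · have := expect_mono M (F := fun d => (-1) * K d) (G := fun d => F d - G d)
      (fun d => by have := (abs_le.1 (h d)).1; linarith)
    rw [expect_const_mul] at this
    linarith
  · exact expect_mono M (fun d => (abs_le.1 (h d)).2)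

theorem expect_of_dependsOn {F : (ℕ → Fin b) → ℝ} {n : ℕ} (hF : DependsOn F (Set.Iio n)) {M : ℕ}
    (hM : n ≤ M) : expect M F = expect n F := by
  induction M, hM using Nat.le_induction with
  | base => rfl
  | succ M hM ih =>
    rw [expect, digitAverage_of_update (fun d a => dependsOn_update hF hM d a), ih]

/-- The Efron–Stein inequality in bounded-difference form. -/
theorem expect_sq_le (M : ℕ) {c : ℝ} (hc : 0 ≤ c) : ∀ F : (ℕ → Fin b) → ℝ,
    (∀ d i a, |F (Function.update d i a) - F d| ≤ c) →
    expect M (fun d => F d ^ 2) ≤ expect M F ^ 2 + M * c ^ 2 := by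
  have hb : (0 : ℝ) < b := by exact_mod_cast NeZero.pos b
  induction M with
  | zero => intro F _; simp [expect]
  | succ M ih =>
    intro F hF
    -- Averaging out the last digit preserves the bounded differences, so the induction hypothesis
    -- applies to the average.
    have h1 : ∀ d i a, |digitAverage M F (Function.update d i a) - digitAverage M F d| ≤ c := by
      intro d i a
      by_cases hi : i = M
      · subst hi
        simpa [digitAverage] using hc
      · unfold digitAverage
        rw [← sub_div, ← Finset.sum_sub_distrib, abs_div, abs_of_pos hb, div_le_iff₀ hb]
        refine (Finset.abs_sum_le_sum_abs _ _).trans ?_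
        refine (Finset.sum_le_card_nsmul _ _ c ?_).trans (by simp [mul_comm])
        intro e _
        rw [Function.update_comm hi]
        exact hF _ _ _
    -- The conditional variance in the last digit is at most `c ^ 2`, because every value lies
    -- within `c` of the mean.
    have h2 : ∀ d, digitAverage M (fun d => F d ^ 2) d ≤ digitAverage M F d ^ 2 + c ^ 2 := by
      intro d
      set g := digitAverage M F d with hg
      have hgs : ∑ a : Fin b, F (Function.update d M a) = g * b := by
        rw [hg, digitAverage]; field_simp
      have h3 : ∀ a : Fin b, |F (Function.update d M a) - g| ≤ c := by
        intro a
        have h4 : F (Function.update d M a) - g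
            = (∑ e : Fin b, (F (Function.update d M a) - F (Function.update d M e))) / b := by
          rw [Finset.sum_sub_distrib, hgs]
          simp
          field_simp
        rw [h4, abs_div, abs_of_pos hb, div_le_iff₀ hb]
        refine (Finset.abs_sum_le_sum_abs _ _).trans ?_
        refine (Finset.sum_le_card_nsmul _ _ c ?_).trans (by simp [mul_comm])
        intro e _
        have := hF (Function.update d M e) M a
        rwa [Function.update_idem] at this
      have h5 : ∑ a : Fin b, (F (Function.update d M a) - g) ^ 2 ≤ b * c ^ 2 := by
        refine (Finset.sum_le_card_nsmul _ _ (c ^ 2) ?_).trans (by simp)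
        intro a _
        exact sq_le_sq' (abs_le.1 (h3 a)).1 (abs_le.1 (h3 a)).2
      have h6 : ∑ a : Fin b, (F (Function.update d M a) - g) ^ 2
          = ∑ a : Fin b, F (Function.update d M a) ^ 2 - b * g ^ 2 := by
        have : ∀ a : Fin b, (F (Function.update d M a) - g) ^ 2
            = F (Function.update d M a) ^ 2 - 2 * g * F (Function.update d M a) + g ^ 2 := by
          intro a; ring
        simp only [this, Finset.sum_add_distrib, Finset.sum_sub_distrib, ← Finset.mul_sum, hgs]
        simp
        ring
      rw [digitAverage, div_le_iff₀ hb]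
      linarith
    calc expect (M + 1) (fun d => F d ^ 2)
        ≤ expect M (fun d => digitAverage M F d ^ 2 + c ^ 2) := expect_mono M h2
      _ = expect M (fun d => digitAverage M F d ^ 2) + c ^ 2 := by
          rw [expect_add, expect_const]
      _ ≤ expect (M + 1) F ^ 2 + (M + 1 : ℕ) * c ^ 2 := by
          have := ih _ h1
          rw [expect]
          push_cast
          linarith

theorem expect_variance_le (M : ℕ) {c : ℝ} (hc : 0 ≤ c) (F : (ℕ → Fin b) → ℝ)
    (hF : ∀ d i a, |F (Function.update d i a) - F d| ≤ c) :
    expect M (fun d => (F d - expect M F) ^ 2) ≤ M * c ^ 2 := by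
  have h : (fun d => (F d - expect M F) ^ 2)
      = fun d => (F d ^ 2 - 2 * expect M F * F d) + expect M F ^ 2 := by
    funext d; ring
  rw [h, expect_add, expect_sub, expect_const_mul, expect_const]
  have := expect_sq_le M hc F hF
  linarith

/-- Compactness stands in for a probability measure on infinite sequences. Each finite set of
constraints is satisfiable, since a nonnegative sum cannot exceed its expectation bound everywhere.
The constraint sets are closed and directed, so they have a common point. -/
theorem exists_forall_sum_le {ι : Type*} (G : ι → (ℕ → Fin b) → ℝ) (n : ι → ℕ)
    (hG : ∀ i d, 0 ≤ G i d) (hdep : ∀ i, DependsOn (G i) (Set.Iio (n i))) (s : ι → ℝ)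
    (hs : Summable s) (hE : ∀ i, expect (n i) (G i) ≤ s i) :
    ∃ d, ∀ t : Finset ι, ∑ i ∈ t, G i d ≤ ∑' i, s i := by
  classical
  have hs0 : ∀ i, 0 ≤ s i := fun i => le_trans (by
    have := expect_mono (n i) (F := fun _ => (0 : ℝ)) (hG i)
    rwa [expect_const] at this) (hE i)
  let K : Finset ι → Set (ℕ → Fin b) := fun t => {d | ∑ i ∈ t, G i d ≤ ∑' i, s i}
  have hclosed : ∀ t, IsClosed (K t) := fun t =>
    isClosed_le (continuous_finsetSum _ fun i _ => (isLocallyConstant_of_dependsOn (hdep i)).continuous)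
      continuous_const
  have hne : ∀ t, (K t).Nonempty := by
    intro t
    by_contra hcon
    have hlt : ∀ d, ∑' i, s i < ∑ i ∈ t, G i d := by
      intro d
      by_contra h
      exact hcon ⟨d, not_lt.1 h⟩
    set M := t.sup n with hM
    have hE' : expect M (fun d => ∑ i ∈ t, G i d) ≤ ∑' i, s i := by
      rw [expect_sum]
      refine le_trans (Finset.sum_le_sum fun i hi => ?_) (hs.sum_le_tsum t fun i _ => hs0 i)
      rw [expect_of_dependsOn (hdep i) (Finset.le_sup hi)]
      exact hE i
    -- The minimum is attained and would already exceed the bound, while the expectation is at least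
    -- the minimum.
    obtain ⟨d₀, -, hd₀⟩ := isCompact_univ.exists_isMinOn (Set.univ_nonempty (α := ℕ → Fin b))
      (continuous_finsetSum t fun i _ => (isLocallyConstant_of_dependsOn (hdep i)).continuous).continuousOn
    have := expect_mono M (F := fun _ => ∑ i ∈ t, G i d₀) (G := fun d => ∑ i ∈ t, G i d)
      (fun d => hd₀ (Set.mem_univ d))
    rw [expect_const] at this
    linarith [hlt d₀]
  have hdir : Directed (· ⊇ ·) K := by
    intro t u
    refine ⟨t ∪ u, ?_, ?_⟩
    · intro d hd
      exact (Finset.sum_le_sum_of_subset_of_nonneg Finset.subset_union_left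
        fun i _ _ => hG i d).trans hd
    · intro d hd
      exact (Finset.sum_le_sum_of_subset_of_nonneg Finset.subset_union_right
        fun i _ _ => hG i d).trans hd
  obtain ⟨d, hd⟩ := IsCompact.nonempty_iInter_of_directed_nonempty_isCompact_isClosed K hdir hne
    (fun t => (hclosed t).isCompact) hclosed
  exact ⟨d, fun t => Set.mem_iInter.1 hd t⟩

/-- Almost sure convergence to the mean, simultaneously for countably many sequences of functions
with bounded differences. -/
theorem exists_tendsto_sub_expect {ι : Type*} [Countable ι] (F : ι → ℕ → (ℕ → Fin b) → ℝ)
    (n : ι → ℕ → ℕ) (c : ι → ℕ → ℝ) (hc : ∀ i m, 0 ≤ c i m)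
    (hdep : ∀ i m, DependsOn (F i m) (Set.Iio (n i m)))
    (hF : ∀ i m d j a, |F i m (Function.update d j a) - F i m d| ≤ c i m)
    (hsum : ∀ i, Summable fun m => (n i m : ℝ) * c i m ^ 2) :
    ∃ d, ∀ i, Tendsto (fun m => F i m d - expect (n i m) (F i m)) atTop (𝓝 0) := by
  classical
  have := Encodable.ofCountable ι
  obtain ⟨ε, hε, S, hS, _⟩ := posSumOfEncodable one_pos ι
  have hterm : ∀ i m, 0 ≤ (n i m : ℝ) * c i m ^ 2 := fun i m => by positivity
  set T : ι → ℝ := fun i => ∑' m, (n i m : ℝ) * c i m ^ 2 with hT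
  have hT0 : ∀ i, 0 ≤ T i := fun i => tsum_nonneg (hterm i)
  -- These weights make the variance bounds summable over all pairs at once; being positive, they
  -- can be divided out for each fixed `i`.
  set ω : ι → ℝ := fun i => ε i / (1 + T i) with hω
  have hω0 : ∀ i, 0 < ω i := fun i => div_pos (hε i) (by linarith [hT0 i])
  have hs : Summable fun p : ι × ℕ => ω p.1 * ((n p.1 p.2 : ℝ) * c p.1 p.2 ^ 2) := by
    have hnn : (0 : ι × ℕ → ℝ) ≤ fun p => ω p.1 * ((n p.1 p.2 : ℝ) * c p.1 p.2 ^ 2) :=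
      fun p => mul_nonneg (hω0 p.1).le (hterm p.1 p.2)
    rw [summable_prod_of_nonneg hnn]
    have h0 : ∀ i, Summable fun m => ω i * ((n i m : ℝ) * c i m ^ 2) :=
      fun i => (hsum i).mul_left (ω i)
    refine ⟨h0, ?_⟩
    refine Summable.of_nonneg_of_le (fun i => tsum_nonneg fun m =>
      mul_nonneg (hω0 i).le (hterm i m)) (fun i => ?_) hS.summable
    have h1 := hT0 i
    have h2 : ∑' m, ω i * ((n i m : ℝ) * c i m ^ 2) = ω i * T i := tsum_mul_left
    refine h2.trans_le ?_
    change ε i / (1 + T i) * T i ≤ ε i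
    rw [div_mul_eq_mul_div, div_le_iff₀ (by linarith)]
    nlinarith [hε i]
  have hdep' : ∀ p : ι × ℕ, DependsOn (fun d => ω p.1 *
      (F p.1 p.2 d - expect (n p.1 p.2) (F p.1 p.2)) ^ 2) (Set.Iio (n p.1 p.2)) := by
    intro p x y hxy
    simp only [hdep p.1 p.2 hxy]
  obtain ⟨d, hd⟩ := exists_forall_sum_le (fun (p : ι × ℕ) d => ω p.1 *
      (F p.1 p.2 d - expect (n p.1 p.2) (F p.1 p.2)) ^ 2) (fun p => n p.1 p.2)
    (fun p d => mul_nonneg (hω0 _).le (sq_nonneg _)) hdep' _ hs (fun p => by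
      rw [expect_const_mul]
      exact mul_le_mul_of_nonneg_left (expect_variance_le _ (hc _ _) _ (hF _ _)) (hω0 _).le)
  refine ⟨d, fun i => ?_⟩
  have hsq : Summable fun m => (F i m d - expect (n i m) (F i m)) ^ 2 := by
    have hnn : (0 : ι × ℕ → ℝ) ≤ fun p => ω p.1 *
        (F p.1 p.2 d - expect (n p.1 p.2) (F p.1 p.2)) ^ 2 :=
      fun p => mul_nonneg (hω0 p.1).le (sq_nonneg _)
    have h1 := summable_of_sum_le hnn hd
    have h2 := (h1.prod_factor i).mul_left (ω i)⁻¹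
    refine h2.congr fun m => ?_
    have := (hω0 i).ne'
    field_simp
  have h0 := hsq.tendsto_atTop_zero
  rw [tendsto_zero_iff_abs_tendsto_zero]
  have h1 := (Real.continuous_sqrt.tendsto 0).comp h0
  simpa [Function.comp_def, Real.sqrt_sq_eq_abs] using h1

end Averaging

/-! ### Counting occurrences by starting position -/

section Counting

variable {b : ℕ}

/-- The word of length `k` that starts at position `i` of `d`. -/
def subword (d : ℕ → Fin b) (i k : ℕ) : Fin k → Fin b := fun t => d (i + t)

/-- The number of positions `i < N` at which `w` occurs in `d`. -/
def hitCount (d : ℕ → Fin b) (N : ℕ) {k : ℕ} (w : Fin k → Fin b) : ℕ :=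
  ((Finset.range N).filter fun i => subword d i k = w).card

/-- The proportion of words of length `k` that occur in `d` at exactly `j` positions `i < N`. -/
noncomputable def hitProportion (d : ℕ → Fin b) (N k j : ℕ) : ℝ :=
  ((Finset.univ.filter fun w : Fin k → Fin b => hitCount d N w = j).card : ℝ) / (b : ℝ) ^ k

theorem W_eq_hitCount (d : ℕ → Fin b) (n : ℕ) {k : ℕ} (w : Fin k → Fin b) :
    W d n w = hitCount d (n + 1 - k) w := by
  unfold W hitCount
  congr 1
  ext i
  simp only [Finset.mem_filter, Finset.mem_range, subword, funext_iff]
  constructor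
  · rintro ⟨h1, h2, h3⟩
    exact ⟨by omega, h3⟩
  · rintro ⟨h1, h3⟩
    exact ⟨by omega, by omega, h3⟩

/-- The summand `k` in the length exactly compensates for the word length, leaving `⌊lam * b ^ k⌋ +
1` starting positions. -/
theorem Z_eq_hitProportion (d : ℕ → Fin b) {lam : ℝ} (hlam : 0 ≤ lam) (j k : ℕ) :
    Z d lam j k = hitProportion d (⌊lam * (b : ℝ) ^ k⌋₊ + 1) k j := by
  unfold Z hitProportion
  rw [Nat.floor_add_natCast (by positivity)]
  have h : ∀ m : ℕ, m + k + 1 - k = m + 1 := by intro m; omega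
  simp only [W_eq_hitCount, h]
  rw [one_div, inv_mul_eq_div]

theorem subword_update (d : ℕ → Fin b) {i m k : ℕ} (a : Fin b) (h : m ∉ Finset.Ico i (i + k)) :
    subword (Function.update d m a) i k = subword d i k := by
  funext t
  have := t.2
  simp only [Finset.mem_Ico] at h
  exact Function.update_of_ne (by omega) _ _

theorem hitCount_succ (d : ℕ → Fin b) (N : ℕ) {k : ℕ} (w : Fin k → Fin b) :
    hitCount d (N + 1) w = hitCount d N w + if subword d N k = w then 1 else 0 := by
  unfold hitCount
  rw [Finset.range_add_one, Finset.filter_insert]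
  split_ifs with h
  · rw [Finset.card_insert_of_notMem (by simp)]
  · simp

theorem hitCount_mono (d : ℕ → Fin b) {N N' : ℕ} (h : N ≤ N') {k : ℕ} (w : Fin k → Fin b) :
    hitCount d N w ≤ hitCount d N' w :=
  Finset.card_le_card (Finset.filter_subset_filter _ (Finset.range_mono h))

theorem hitCount_congr {d e : ℕ → Fin b} {N k : ℕ} (h : ∀ i < N, subword d i k = subword e i k)
    (w : Fin k → Fin b) : hitCount d N w = hitCount e N w := by
  unfold hitCount
  congr 1
  apply Finset.filter_congr
  intro i hi
  rw [h i (Finset.mem_range.1 hi)]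

theorem hitCount_le_add {d e : ℕ → Fin b} {N k : ℕ} (T : Finset ℕ)
    (h : ∀ i < N, i ∉ T → subword d i k = subword e i k) (w : Fin k → Fin b) :
    hitCount d N w ≤ hitCount e N w + T.card := by
  classical
  unfold hitCount
  refine (Finset.card_le_card ?_).trans (Finset.card_union_le _ _)
  intro i hi
  rw [Finset.mem_filter] at hi
  rw [Finset.mem_union, Finset.mem_filter]
  by_cases hT : i ∈ T
  · exact Or.inr hT
  · exact Or.inl ⟨hi.1, by rw [← h i (Finset.mem_range.1 hi.1) hT, hi.2]⟩

theorem abs_hitCount_sub_le {d e : ℕ → Fin b} {N k : ℕ} (T : Finset ℕ)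
    (h : ∀ i < N, i ∉ T → subword d i k = subword e i k) (w : Fin k → Fin b) :
    |(hitCount d N w : ℝ) - hitCount e N w| ≤ T.card := by
  have h1 : (hitCount d N w : ℝ) ≤ hitCount e N w + T.card := by
    exact_mod_cast hitCount_le_add T h w
  have h2 : (hitCount e N w : ℝ) ≤ hitCount d N w + T.card := by
    exact_mod_cast hitCount_le_add T (fun i hi hT => (h i hi hT).symm) w
  rw [abs_le]
  constructor <;> linarith

theorem abs_hitProportion_sub_le {d e : ℕ → Fin b} {N N' k : ℕ} (j : ℕ)
    (U : Finset (Fin k → Fin b)) (h : ∀ w ∉ U, hitCount d N w = hitCount e N' w) :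
    |hitProportion d N k j - hitProportion e N' k j| ≤ U.card / (b : ℝ) ^ k := by
  classical
  have key : ∀ {d e : ℕ → Fin b} {N N' : ℕ}, (∀ w ∉ U, hitCount d N w = hitCount e N' w) →
      (Finset.univ.filter fun w : Fin k → Fin b => hitCount d N w = j).card
        ≤ (Finset.univ.filter fun w : Fin k → Fin b => hitCount e N' w = j).card + U.card := by
    intro d e N N' h
    refine (Finset.card_le_card ?_).trans (Finset.card_union_le _ _)
    intro w hw
    rw [Finset.mem_filter] at hw
    rw [Finset.mem_union, Finset.mem_filter]
    by_cases hU : w ∈ U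
    · exact Or.inr hU
    · exact Or.inl ⟨Finset.mem_univ _, by rw [← h w hU, hw.2]⟩
  have h1 := key h
  have h2 := key (fun w hw => (h w hw).symm)
  rw [← Nat.cast_le (α := ℝ)] at h1 h2
  push_cast at h1 h2
  unfold hitProportion
  rw [← sub_div, abs_div, abs_of_nonneg (by positivity : (0 : ℝ) ≤ (b : ℝ) ^ k)]
  gcongr
  rw [abs_le]
  constructor <;> linarith

/-- Only words read at a position of `T`, in `d` or in `e`, can change their count; this is the
source of the factor `2`. -/
theorem abs_hitProportion_sub_le_of_eqOn {d e : ℕ → Fin b} {N k : ℕ} (j : ℕ) (T : Finset ℕ)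
    (h : ∀ i < N, i ∉ T → subword d i k = subword e i k) :
    |hitProportion d N k j - hitProportion e N k j| ≤ 2 * T.card / (b : ℝ) ^ k := by
  classical
  have h1 := abs_hitProportion_sub_le (d := d) (e := e) (N := N) (N' := N) j
    (T.image (fun i => subword d i k) ∪ T.image (fun i => subword e i k)) ?_
  · refine h1.trans ?_
    gcongr
    have h2 := (Finset.card_union_le (T.image fun i => subword d i k)
      (T.image fun i => subword e i k)).trans
        (Nat.add_le_add Finset.card_image_le Finset.card_image_le)
    rw [← two_mul] at h2
    exact_mod_cast h2
  · intro w hw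
    simp only [Finset.mem_union, Finset.mem_image, not_or, not_exists, not_and] at hw
    unfold hitCount
    congr 1
    apply Finset.filter_congr
    intro i hi
    by_cases hT : i ∈ T
    · exact iff_of_false (hw.1 i hT) (hw.2 i hT)
    · rw [h i (Finset.mem_range.1 hi) hT]

theorem abs_hitProportion_sub_le_of_le (d : ℕ → Fin b) {N N' : ℕ} (k j : ℕ) (hN : N ≤ N') :
    |hitProportion d N k j - hitProportion d N' k j| ≤ ((N' : ℝ) - N) / (b : ℝ) ^ k := by
  classical
  have h1 := abs_hitProportion_sub_le (d := d) (e := d) (N := N) (N' := N') j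
    ((Finset.Ico N N').image (fun i => subword d i k)) ?_
  · refine h1.trans ?_
    gcongr
    have h2 := Finset.card_image_le (s := Finset.Ico N N') (f := fun i => subword d i k)
    rw [Nat.card_Ico] at h2
    rw [← Nat.cast_sub hN]
    exact_mod_cast h2
  · intro w hw
    simp only [Finset.mem_image, Finset.mem_Ico, not_exists, not_and] at hw
    unfold hitCount
    congr 1
    ext i
    simp only [Finset.mem_filter, Finset.mem_range]
    constructor
    · rintro ⟨h1, h2⟩
      exact ⟨by omega, h2⟩
    · rintro ⟨h1, h2⟩
      refine ⟨?_, h2⟩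
      by_contra hlt
      exact hw i ⟨by omega, h1⟩ h2

/-- This window contains every starting position whose length-`k` word covers the digit at `m`; it
may be cut off at `0`. -/
theorem card_window_le (m k : ℕ) :
    (Finset.Ico (m + 1 - k) (m + 1)).card ≤ k := by
  rw [Nat.card_Ico]; omega

theorem subword_update_of_notMem (d : ℕ → Fin b) {i m k : ℕ} (a : Fin b)
    (h : i ∉ Finset.Ico (m + 1 - k) (m + 1)) :
    subword (Function.update d m a) i k = subword d i k := by
  apply subword_update
  simp only [Finset.mem_Ico] at h ⊢
  omega

theorem abs_hitCount_update_sub_le (d : ℕ → Fin b) (m N : ℕ) (a : Fin b) {k : ℕ}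
    (w : Fin k → Fin b) :
    |(hitCount (Function.update d m a) N w : ℝ) - hitCount d N w| ≤ k := by
  refine (abs_hitCount_sub_le (Finset.Ico (m + 1 - k) (m + 1))
    (fun i _ hi => subword_update_of_notMem d a hi) w).trans ?_
  exact_mod_cast card_window_le m k

theorem abs_hitProportion_update_sub_le (d : ℕ → Fin b) (m N k j : ℕ) (a : Fin b) :
    |hitProportion (Function.update d m a) N k j - hitProportion d N k j|
      ≤ 2 * k / (b : ℝ) ^ k := by
  refine (abs_hitProportion_sub_le_of_eqOn j (Finset.Ico (m + 1 - k) (m + 1))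
    (fun i _ hi => subword_update_of_notMem d a hi)).trans ?_
  gcongr
  exact card_window_le m k

theorem dependsOn_subword {α : Type*} (i k : ℕ) (f : (Fin k → Fin b) → α) :
    DependsOn (fun d : ℕ → Fin b => f (subword d i k)) (Set.Iio (i + k)) := by
  intro d e h
  have : subword d i k = subword e i k := by
    funext t
    exact h (i + t) (by have := t.2; simp)
  simp only [this]

theorem dependsOn_hitCount (N : ℕ) {k : ℕ} (w : Fin k → Fin b) :
    DependsOn (fun d : ℕ → Fin b => hitCount d N w) (Set.Iio (N + k - 1)) := by
  intro d e h
  apply hitCount_congr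
  intro i hi
  funext t
  exact h (i + t) (by have := t.2; simp only [Set.mem_Iio]; omega)

theorem dependsOn_hitProportion (N k j : ℕ) :
    DependsOn (fun d : ℕ → Fin b => hitProportion d N k j) (Set.Iio (N + k - 1)) := by
  intro d e h
  have h1 : ∀ w : Fin k → Fin b, hitCount d N w = hitCount e N w :=
    fun w => dependsOn_hitCount N w h
  simp only [hitProportion, h1]

end Counting

/-! ### The Poisson differential equations and their Euler scheme -/

section PoissonWeight

/-- The Poisson probabilities. -/
noncomputable def poissonWeight (t : ℝ) (j : ℕ) : ℝ := Real.exp (-t) * (t ^ j / (Nat.factorial j : ℝ))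

/-- The sequence `g` shifted to the right by one, with `0` in front. -/
def shiftRight (g : ℕ → ℝ) : ℕ → ℝ
  | 0 => 0
  | j + 1 => g j

theorem poissonWeight_nonneg {t : ℝ} (ht : 0 ≤ t) (j : ℕ) : 0 ≤ poissonWeight t j := by
  unfold poissonWeight; positivity

theorem poissonWeight_le_one {t : ℝ} (ht : 0 ≤ t) (j : ℕ) : poissonWeight t j ≤ 1 := by
  unfold poissonWeight
  rw [Real.exp_neg, inv_mul_le_one₀ (Real.exp_pos t)]
  exact Real.pow_div_factorial_le_exp t ht j

theorem abs_shiftRight_sub_le {g h : ℕ → ℝ} {c : ℝ} (hc : 0 ≤ c) (H : ∀ j, |g j - h j| ≤ c)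
    (j : ℕ) : |shiftRight g j - shiftRight h j| ≤ c := by
  cases j with
  | zero => simpa [shiftRight] using hc
  | succ j => exact H j

theorem hasDerivAt_poissonWeight (t : ℝ) (j : ℕ) :
    HasDerivAt (fun t => poissonWeight t j)
      (shiftRight (poissonWeight t) j - poissonWeight t j) t := by
  have h1 : HasDerivAt (fun t : ℝ => Real.exp (-t)) (-Real.exp (-t)) t := by
    simpa using (hasDerivAt_neg t).exp
  cases j with
  | zero => simpa [poissonWeight, shiftRight] using h1
  | succ j =>
    have h2 : HasDerivAt (fun t : ℝ => t ^ (j + 1) / (Nat.factorial (j + 1) : ℝ))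
        (((j + 1 : ℕ) : ℝ) * t ^ j / (Nat.factorial (j + 1) : ℝ)) t := by
      simpa using (hasDerivAt_pow (j + 1) t).div_const (Nat.factorial (j + 1) : ℝ)
    refine (h1.mul h2).congr_deriv ?_
    have h3 : (Nat.factorial j : ℝ) ≠ 0 := by positivity
    simp only [poissonWeight, shiftRight, Nat.factorial_succ]
    push_cast
    field_simp
    ring

theorem abs_poissonWeight_sub_le {s t : ℝ} (hs : 0 ≤ s) (ht : 0 ≤ t) (j : ℕ) :
    |poissonWeight t j - poissonWeight s j| ≤ |t - s| := by
  have h := (convex_Ici (0 : ℝ)).norm_image_sub_le_of_norm_hasDerivWithin_le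
    (f := fun t => poissonWeight t j) (C := 1)
    (fun x _ => (hasDerivAt_poissonWeight x j).hasDerivWithinAt) (fun x hx => ?_)
    (show s ∈ Set.Ici (0 : ℝ) from hs) (show t ∈ Set.Ici (0 : ℝ) from ht)
  · simpa using h
  · have hx0 : (0 : ℝ) ≤ x := hx
    have h1 := poissonWeight_nonneg hx0 j
    have h2 := poissonWeight_le_one hx0 j
    have h3 : 0 ≤ shiftRight (poissonWeight x) j ∧ shiftRight (poissonWeight x) j ≤ 1 := by
      cases j with
      | zero => simp [shiftRight]
      | succ j => exact ⟨poissonWeight_nonneg hx0 j, poissonWeight_le_one hx0 j⟩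
    rw [Real.norm_eq_abs, abs_le]
    constructor <;> linarith [h3.1, h3.2]

/-- Local error of one Euler step: the derivative differs from its value at `t` by at most `2 * h`
on the step, since each weight is 1-Lipschitz in time. -/
theorem abs_poissonWeight_add_sub_le {t h : ℝ} (ht : 0 ≤ t) (hh : 0 ≤ h) (j : ℕ) :
    |poissonWeight (t + h) j
      - (poissonWeight t j + h * (shiftRight (poissonWeight t) j - poissonWeight t j))|
      ≤ 2 * h ^ 2 := by
  set c := shiftRight (poissonWeight t) j - poissonWeight t j with hc
  have hd : ∀ s : ℝ, HasDerivAt (fun s => poissonWeight (t + s) j - s * c)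
      (shiftRight (poissonWeight (t + s)) j - poissonWeight (t + s) j - c) s := by
    intro s
    have h1 := (hasDerivAt_poissonWeight (t + s) j).comp_const_add t s
    have h2 := (hasDerivAt_id s).mul_const c
    simpa using (h1.fun_sub h2)
  have hmv := (convex_Icc (0 : ℝ) h).norm_image_sub_le_of_norm_hasDerivWithin_le
    (f := fun s => poissonWeight (t + s) j - s * c) (C := 2 * h)
    (fun x _ => (hd x).hasDerivWithinAt) (fun x hx => ?_)
    (Set.left_mem_Icc.2 hh) (Set.right_mem_Icc.2 hh)
  · simp only [add_zero, zero_mul, sub_zero, Real.norm_eq_abs, abs_of_nonneg hh] at hmv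
    have e : poissonWeight (t + h) j - (poissonWeight t j + h * c)
        = poissonWeight (t + h) j - h * c - poissonWeight t j := by ring
    rw [e]
    exact hmv.trans (by rw [pow_two, mul_assoc])
  · have hx0 : 0 ≤ x := hx.1
    have h1 : ∀ j, |poissonWeight (t + x) j - poissonWeight t j| ≤ x := fun j => by
      simpa [abs_of_nonneg hx0] using abs_poissonWeight_sub_le ht (by linarith : 0 ≤ t + x) j
    have h2 := abs_le.1 (abs_shiftRight_sub_le hx0 h1 j)
    have h3 := abs_le.1 (h1 j)
    have := hx.2
    rw [Real.norm_eq_abs, abs_le, hc]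
    constructor <;> linarith [h2.1, h2.2, h3.1, h3.2]

/-- Approximate solutions of the Euler scheme for the Poisson probabilities are close to them. -/
theorem abs_sub_poissonWeight_le_of_recurrence {p : ℕ → ℕ → ℝ} {h δ : ℝ} (hh : 0 ≤ h) (hh1 : h ≤ 1)
    (N : ℕ) (h0 : ∀ j, p 0 j = if j = 0 then 1 else 0)
    (hrec : ∀ n < N, ∀ j, |p (n + 1) j - (p n j + h * (shiftRight (p n) j - p n j))| ≤ δ) :
    ∀ n ≤ N, ∀ j, |p n j - poissonWeight (n * h) j| ≤ n * (δ + 2 * h ^ 2) := by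
  intro n
  induction n with
  | zero =>
    intro _ j
    rw [h0]
    cases j <;> simp [poissonWeight]
  | succ n ih =>
    intro hn j
    have ih := ih (by omega)
    have h1 := hrec n (by omega) j
    have hnn : (0 : ℝ) ≤ n * h := by positivity
    have h2 := abs_poissonWeight_add_sub_le hnn hh j
    have h3 := ih j
    have hδ : (0 : ℝ) ≤ n * (δ + 2 * h ^ 2) := (abs_nonneg _).trans h3
    have h4 := abs_shiftRight_sub_le hδ ih j
    have e : ((n + 1 : ℕ) : ℝ) * h = n * h + h := by push_cast; ring
    rw [e]
    push_cast
    -- For `0 ≤ h ≤ 1` the Euler step is a convex combination, so earlier errors are not amplified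
    -- and only the local errors add up.
    have h5 : |(1 - h) * (p n j - poissonWeight (n * h) j)
        + h * (shiftRight (p n) j - shiftRight (poissonWeight (n * h)) j)|
        ≤ n * (δ + 2 * h ^ 2) := by
      refine (abs_add_le _ _).trans ?_
      rw [abs_mul, abs_mul, abs_of_nonneg hh, abs_of_nonneg (by linarith : 0 ≤ 1 - h)]
      nlinarith
    rw [abs_le] at *
    constructor <;> nlinarith [h1.1, h1.2, h2.1, h2.2, h5.1, h5.2]

end PoissonWeight

/-! ### Expected proportions approximate the Poisson weights -/

section Expectation

variable {b : ℕ}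

theorem hitProportion_eq_sum (d : ℕ → Fin b) (N k j : ℕ) :
    hitProportion d N k j
      = (1 / (b : ℝ) ^ k) * ∑ w : Fin k → Fin b, if hitCount d N w = j then (1 : ℝ) else 0 := by
  simp [hitProportion]
  ring

/-- A new starting position affects a single word, the one read there, and moves it from one count
class to the next. -/
theorem hitProportion_succ (d : ℕ → Fin b) (N k j : ℕ) :
    hitProportion d (N + 1) k j = hitProportion d N k j + (1 / (b : ℝ) ^ k) *
      (shiftRight (fun j => if hitCount d N (subword d N k) = j then (1 : ℝ) else 0) j
        - if hitCount d N (subword d N k) = j then (1 : ℝ) else 0) := by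
  rw [hitProportion_eq_sum, hitProportion_eq_sum, ← mul_add]
  congr 1
  have h : ∀ w : Fin k → Fin b, (if hitCount d (N + 1) w = j then (1 : ℝ) else 0)
      = (if hitCount d N w = j then (1 : ℝ) else 0) + if subword d N k = w then
        (shiftRight (fun j => if hitCount d N w = j then (1 : ℝ) else 0) j
        - if hitCount d N w = j then (1 : ℝ) else 0) else 0 := by
    intro w
    rw [hitCount_succ]
    by_cases hw : subword d N k = w
    · cases j <;> simp [hw, shiftRight]
    · simp [hw]
  simp only [h, Finset.sum_add_distrib, Finset.sum_ite_eq, Finset.mem_univ, if_true]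

theorem abs_indicator_hitCount_sub_le (d : ℕ → Fin b) {m n k : ℕ} (hmn : m ≤ n) (j : ℕ)
    (v : Fin k → Fin b) :
    |(if hitCount d n v = j then (1 : ℝ) else 0) - if hitCount d m v = j then (1 : ℝ) else 0|
      ≤ ∑ i ∈ Finset.Ico m n, if subword d i k = v then (1 : ℝ) else 0 := by
  have hnn : ∀ i ∈ Finset.Ico m n, (0 : ℝ) ≤ if subword d i k = v then (1 : ℝ) else 0 := by
    intro i _; split_ifs <;> norm_num
  by_cases h : ∃ i ∈ Finset.Ico m n, subword d i k = v
  · obtain ⟨i, hi, hv⟩ := h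
    have h1 := Finset.single_le_sum hnn hi
    rw [if_pos hv] at h1
    refine le_trans ?_ h1
    split_ifs <;> norm_num
  · have h1 : hitCount d n v = hitCount d m v := by
      unfold hitCount
      congr 1
      ext i
      simp only [Finset.mem_filter, Finset.mem_range]
      constructor
      · rintro ⟨h2, h3⟩
        refine ⟨?_, h3⟩
        by_contra hlt
        exact h ⟨i, Finset.mem_Ico.2 ⟨by omega, h2⟩, h3⟩
      · rintro ⟨h2, h3⟩
        exact ⟨by omega, h3⟩
    rw [h1, sub_self, abs_zero]
    exact Finset.sum_nonneg hnn

variable [NeZero b]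

theorem expect_mul_indicator_digit {n : ℕ} {F : (ℕ → Fin b) → ℝ} (hF : DependsOn F (Set.Iio n))
    {D : (ℕ → Fin b) → Fin b} (hD : DependsOn D (Set.Iio n)) :
    expect (n + 1) (fun d => F d * if d n = D d then 1 else 0) = (1 / (b : ℝ)) * expect n F := by
  rw [← expect_const_mul, expect]
  congr 1
  funext d
  have h1 : ∀ a, D (Function.update d n a) = D d := fun a => hD fun i hi =>
    Function.update_of_ne (ne_of_lt hi) _ _
  simp only [digitAverage, dependsOn_update hF le_rfl, h1, Function.update_self]
  simp
  ring

/-- The digits of the block are revealed in turn, each matching its target with probability `1 / b`.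
The target `D s` may depend on earlier digits of the same block, which is what covers overlapping
words. -/
theorem expect_mul_indicator_block {n : ℕ} {F : (ℕ → Fin b) → ℝ} (hF : DependsOn F (Set.Iio n))
    {D : ℕ → (ℕ → Fin b) → Fin b} (hD : ∀ s, DependsOn (D s) (Set.Iio (n + s))) (k : ℕ) :
    expect (n + k) (fun d => F d * if ∀ s < k, d (n + s) = D s d then 1 else 0)
      = (1 / (b : ℝ) ^ k) * expect n F := by
  induction k with
  | zero => simp
  | succ k ih =>
    have hG : DependsOn (fun d => F d * if ∀ s < k, d (n + s) = D s d then (1 : ℝ) else 0)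
        (Set.Iio (n + k)) := by
      intro d e h
      have h1 : F d = F e := hF fun i hi => h i (lt_of_lt_of_le hi (Nat.le_add_right _ _))
      have h2 : ∀ s < k, D s d = D s e := fun s hs => hD s fun i hi =>
        h i (by have : i < n + s := hi; simp only [Set.mem_Iio]; omega)
      have h3 : (∀ s < k, d (n + s) = D s d) ↔ ∀ s < k, e (n + s) = D s e := by
        refine forall₂_congr fun s hs => ?_
        rw [h2 s hs, h (n + s) (by simpa using hs)]
      simp only [h1, h3]
    have h := expect_mul_indicator_digit hG (hD k)
    rw [ih] at h
    rw [← add_assoc]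
    refine Eq.trans ?_ (h.trans ?_)
    · congr 1
      funext d
      rw [mul_assoc]
      congr 1
      simp only [Nat.forall_lt_succ_right]
      by_cases h1 : ∀ s < k, d (n + s) = D s d <;> by_cases h2 : d (n + k) = D k d <;>
        simp [h1, h2]
    · rw [pow_succ]
      ring

theorem expect_mul_indicator_subword {n k M : ℕ} (hM : n + k ≤ M) {F : (ℕ → Fin b) → ℝ}
    (hF : DependsOn F (Set.Iio n)) (w : Fin k → Fin b) :
    expect M (fun d => F d * if subword d n k = w then 1 else 0)
      = (1 / (b : ℝ) ^ k) * expect M F := by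
  rw [expect_of_dependsOn hF (by omega : n ≤ M), expect_of_dependsOn _ hM]
  · have h := expect_mul_indicator_block hF
      (D := fun s _ => if hs : s < k then w ⟨s, hs⟩ else 0) (fun s d e _ => rfl) k
    rw [← h]
    congr 1
    funext d
    congr 2
    rw [funext_iff, Fin.forall_iff, eq_iff_iff]
    refine forall₂_congr fun s hs => ?_
    simp [subword, hs]
  · intro d e h
    have h1 : F d = F e := hF fun i hi => h i (lt_of_lt_of_le hi (Nat.le_add_right _ _))
    have h2 := dependsOn_subword n k (fun v => if v = w then (1 : ℝ) else 0) h
    simp only [h1] at h2 ⊢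
    rw [h2]

/-- Overlap does no harm: the digit at `n + s` is compared with the one at `i + s`, which has
already been revealed. -/
theorem expect_indicator_subword_eq {i n k M : ℕ} (hi : i < n) (hM : n + k ≤ M) :
    expect M (fun d : ℕ → Fin b => if subword d i k = subword d n k then (1 : ℝ) else 0)
      = 1 / (b : ℝ) ^ k := by
  rw [expect_of_dependsOn _ hM]
  · have h := expect_mul_indicator_block (b := b) (n := n) (F := fun _ => 1) (fun _ _ _ => rfl)
      (D := fun s d => d (i + s)) (fun s d e h => h (i + s) (by simpa using hi)) k
    rw [expect_const, mul_one] at h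
    rw [← h]
    congr 1
    funext d
    rw [one_mul]
    congr 1
    rw [funext_iff, Fin.forall_iff, eq_iff_iff]
    refine forall₂_congr fun s hs => ?_
    simp [subword, eq_comm]
  · intro d e h
    have h1 : ∀ m ≤ n, subword d m k = subword e m k := by
      intro m hm
      funext t
      exact h (m + t) (by have := t.2; simp only [Set.mem_Iio]; omega)
    simp only [h1 i hi.le, h1 n le_rfl]

theorem expect_hitCount {N k M : ℕ} (hM : N + k ≤ M) (w : Fin k → Fin b) :
    expect M (fun d => (hitCount d N w : ℝ)) = N / (b : ℝ) ^ k := by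
  have h : (fun d : ℕ → Fin b => (hitCount d N w : ℝ))
      = fun d => ∑ i ∈ Finset.range N, if subword d i k = w then (1 : ℝ) else 0 := by
    funext d
    simp [hitCount]
  rw [h, expect_sum]
  have h1 : ∀ i ∈ Finset.range N,
      expect M (fun d : ℕ → Fin b => if subword d i k = w then (1 : ℝ) else 0)
        = 1 / (b : ℝ) ^ k := by
    intro i hi
    rw [Finset.mem_range] at hi
    have := expect_mul_indicator_subword (by omega : i + k ≤ M) (F := fun _ => 1)
      (fun _ _ _ => rfl) w
    simpa [expect_const] using this
  rw [Finset.sum_congr rfl h1]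
  simp [div_eq_mul_inv]

/-- When the first `m` occurrences do not overlap the word at `n`, that word is uniform and
independent of them. -/
theorem expect_indicator_hitCount_subword {m n k M : ℕ} (hmn : m + k ≤ n ∨ m = 0) (hM : n + k ≤ M)
    (j : ℕ) :
    expect M (fun d : ℕ → Fin b => if hitCount d m (subword d n k) = j then (1 : ℝ) else 0)
      = expect M (fun d : ℕ → Fin b => hitProportion d m k j) := by
  have h1 : (fun d : ℕ → Fin b => if hitCount d m (subword d n k) = j then (1 : ℝ) else 0)
      = fun d => ∑ w : Fin k → Fin b, (if hitCount d m w = j then (1 : ℝ) else 0)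
        * if subword d n k = w then 1 else 0 := by
    funext d
    simp
  simp only [hitProportion_eq_sum]
  rw [h1, expect_sum, expect_const_mul, expect_sum, Finset.mul_sum]
  refine Finset.sum_congr rfl fun w _ => ?_
  apply expect_mul_indicator_subword hM
  intro d e h
  have : hitCount d m w = hitCount e m w := by
    apply hitCount_congr
    intro i hi
    funext t
    exact h (i + t) (by have := t.2; simp only [Set.mem_Iio]; omega)
  simp only [this]

/-- Dropping the last `k` starting positions creates independence. It costs `k / b ^ k` in the
indicator, by a union bound over possible coincidences, and again `k / b ^ k` when the positions are
restored in the proportion. -/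
theorem abs_expect_indicator_sub_le {n k M : ℕ} (hM : n + k ≤ M) (j : ℕ) :
    |expect M (fun d : ℕ → Fin b => if hitCount d n (subword d n k) = j then (1 : ℝ) else 0)
      - expect M (fun d : ℕ → Fin b => hitProportion d n k j)| ≤ 2 * k / (b : ℝ) ^ k := by
  have hm : n - k ≤ n := Nat.sub_le _ _
  have hk : ((n - (n - k) : ℕ) : ℝ) ≤ k := by exact_mod_cast (by omega : n - (n - k) ≤ k)
  have hb : (0 : ℝ) < (b : ℝ) ^ k := by
    have : (0 : ℝ) < b := by exact_mod_cast NeZero.pos b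
    positivity
  have h1 := abs_expect_sub_le M (fun d : ℕ → Fin b =>
    abs_indicator_hitCount_sub_le d hm j (subword d n k))
  rw [expect_sum, Finset.sum_congr rfl fun i hi =>
    expect_indicator_subword_eq (Finset.mem_Ico.1 hi).2 hM,
    expect_indicator_hitCount_subword (m := n - k) (by omega) hM, Finset.sum_const, Nat.card_Ico,
    nsmul_eq_mul, mul_one_div] at h1
  have h2 := abs_expect_sub_le M (fun d : ℕ → Fin b =>
    abs_hitProportion_sub_le_of_le d k j hm)
  rw [expect_const, ← Nat.cast_sub hm] at h2
  have h3 : ((n - (n - k) : ℕ) : ℝ) / (b : ℝ) ^ k ≤ k / (b : ℝ) ^ k := by gcongr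
  have h4 : 2 * (k : ℝ) / (b : ℝ) ^ k = k / (b : ℝ) ^ k + k / (b : ℝ) ^ k := by ring
  rw [h4]
  exact (abs_sub_le _ _ _).trans (add_le_add (h1.trans h3) (h2.trans h3))

theorem expect_shiftRight (M : ℕ) (g : (ℕ → Fin b) → ℕ → ℝ) (j : ℕ) :
    expect M (fun d => shiftRight (g d) j) = shiftRight (fun j => expect M fun d => g d j) j := by
  cases j with
  | zero => exact expect_const M 0
  | succ j => rfl

theorem abs_expect_hitProportion_sub_poissonWeight_le {N k M : ℕ} (hM : N + k ≤ M) (j : ℕ) :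
    |expect M (fun d : ℕ → Fin b => hitProportion d N k j)
      - poissonWeight (N * (1 / (b : ℝ) ^ k)) j|
      ≤ N * ((4 * k + 2) * (1 / (b : ℝ) ^ k) ^ 2) := by
  set h : ℝ := 1 / (b : ℝ) ^ k with hh
  have hb : (1 : ℝ) ≤ (b : ℝ) ^ k := one_le_pow₀ (by exact_mod_cast NeZero.pos b)
  have hh0 : 0 ≤ h := by positivity
  have hh1 : h ≤ 1 := by rw [hh, div_le_one (by linarith)]; exact hb
  -- The decoupling error `2 * k * h` enters twice and is multiplied by the step size `h`, giving
  -- this `δ`.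
  have key := abs_sub_poissonWeight_le_of_recurrence
    (p := fun n j => expect M fun d : ℕ → Fin b => hitProportion d n k j)
    (δ := 4 * k * h ^ 2) hh0 hh1 N ?_ ?_ N le_rfl j
  · refine key.trans (le_of_eq ?_)
    ring
  · intro j
    have h1 : ∀ d : ℕ → Fin b, hitProportion d 0 k j = if j = 0 then 1 else 0 := by
      intro d
      have hb' : (b : ℝ) ^ k ≠ 0 := by positivity
      by_cases hj : j = 0
      · subst hj
        simp [hitProportion, hitCount, hb']
      · have hj' : ¬ 0 = j := fun h => hj h.symm
        simp [hitProportion, hitCount, hj, hj']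
    simp only [h1, expect_const]
  · intro n hn j
    set S : ℕ → ℝ := fun j => expect M
      (fun d : ℕ → Fin b => if hitCount d n (subword d n k) = j then (1 : ℝ) else 0) with hS
    set P : ℕ → ℝ := fun j => expect M fun d : ℕ → Fin b => hitProportion d n k j with hP
    have h1 : ∀ j, |S j - P j| ≤ 2 * k * h := fun j => by
      have := abs_expect_indicator_sub_le (b := b) (by omega : n + k ≤ M) j
      rwa [div_eq_mul_one_div] at this
    have h2 := abs_shiftRight_sub_le (by positivity) h1 j
    have h3 : expect M (fun d : ℕ → Fin b => hitProportion d (n + 1) k j)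
        = P j + h * (shiftRight S j - S j) := by
      simp only [hitProportion_succ]
      rw [expect_add, expect_const_mul, expect_sub, expect_shiftRight]
    rw [h3]
    have h4 : P j + h * (shiftRight S j - S j) - (P j + h * (shiftRight P j - P j))
        = h * ((shiftRight S j - shiftRight P j) - (S j - P j)) := by ring
    rw [h4, abs_mul, abs_of_nonneg hh0]
    have h5 := (abs_sub (shiftRight S j - shiftRight P j) (S j - P j)).trans
      (add_le_add h2 (h1 j))
    nlinarith

end Expectation

/-! ### Existence of a Poisson generic normal sequence -/

section Existence

variable {b : ℕ}

theorem tendsto_one_div_pow (hb : 2 ≤ b) :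
    Tendsto (fun k : ℕ => 1 / (b : ℝ) ^ k) atTop (𝓝 0) := by
  have hb1 : (1 : ℝ) < b := by exact_mod_cast hb
  simpa [Function.comp_def] using
    tendsto_inv_atTop_zero.comp (tendsto_pow_atTop_atTop_of_one_lt hb1)

theorem tendsto_natFloor_mul_pow_add_one_mul (hb : 2 ≤ b) {lam : ℝ} (hlam : 0 ≤ lam) :
    Tendsto (fun k : ℕ => ((⌊lam * (b : ℝ) ^ k⌋₊ + 1 : ℕ) : ℝ) * (1 / (b : ℝ) ^ k)) atTop
      (𝓝 lam) := by
  have hb1 : (1 : ℝ) < b := by exact_mod_cast hb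
  have h0 := tendsto_one_div_pow hb
  have h1 : Tendsto (fun k : ℕ => lam + 1 / (b : ℝ) ^ k) atTop (𝓝 lam) := by
    simpa using tendsto_const_nhds.add h0
  refine tendsto_of_tendsto_of_tendsto_of_le_of_le tendsto_const_nhds h1 (fun k => ?_)
    (fun k => ?_)
  · have hp : (0 : ℝ) < (b : ℝ) ^ k := by positivity
    have := (Nat.lt_floor_add_one (lam * (b : ℝ) ^ k)).le
    simp only [mul_one_div]
    rw [le_div_iff₀ hp]
    exact_mod_cast this
  · have hp : (0 : ℝ) < (b : ℝ) ^ k := by positivity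
    have := Nat.floor_le (by positivity : 0 ≤ lam * (b : ℝ) ^ k)
    simp only [mul_one_div]
    rw [div_le_iff₀ hp, add_mul, div_mul_cancel₀ _ hp.ne']
    push_cast
    linarith

theorem tendsto_mul_one_div_pow (hb : 2 ≤ b) :
    Tendsto (fun k : ℕ => (k : ℝ) * (1 / (b : ℝ) ^ k)) atTop (𝓝 0) := by
  have hb1 : (1 : ℝ) < b := by exact_mod_cast hb
  have := tendsto_self_mul_const_pow_of_lt_one (r := 1 / (b : ℝ)) (by positivity)
    (by rw [div_lt_one (by linarith)]; exact hb1)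
  simpa [one_div_pow] using this

theorem tendsto_expect_hitProportion [NeZero b] (hb : 2 ≤ b) {lam : ℝ} (hlam : 0 ≤ lam) (j : ℕ) :
    Tendsto (fun k : ℕ => expect (⌊lam * (b : ℝ) ^ k⌋₊ + 1 + k)
      (fun d : ℕ → Fin b => hitProportion d (⌊lam * (b : ℝ) ^ k⌋₊ + 1) k j)) atTop
      (𝓝 (poissonWeight lam j)) := by
  have hb1 : (1 : ℝ) < b := by exact_mod_cast hb
  have hN := tendsto_natFloor_mul_pow_add_one_mul hb hlam
  have h0 := tendsto_one_div_pow hb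
  have h1 : Tendsto (fun k : ℕ =>
      poissonWeight (((⌊lam * (b : ℝ) ^ k⌋₊ + 1 : ℕ) : ℝ) * (1 / (b : ℝ) ^ k)) j) atTop
      (𝓝 (poissonWeight lam j)) :=
    ((hasDerivAt_poissonWeight lam j).continuousAt.tendsto).comp hN
  have h2 : Tendsto (fun k : ℕ => ((⌊lam * (b : ℝ) ^ k⌋₊ + 1 : ℕ) : ℝ) *
      ((4 * k + 2) * (1 / (b : ℝ) ^ k) ^ 2)) atTop (𝓝 0) := by
    have h3 := hN.mul (((tendsto_mul_one_div_pow hb).const_mul 4).add (h0.const_mul 2))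
    simp only [mul_zero, add_zero] at h3
    refine h3.congr fun k => ?_
    ring
  have h3 := squeeze_zero_norm (fun k => by
    have := abs_expect_hitProportion_sub_poissonWeight_le (b := b) (k := k)
      (le_refl (⌊lam * (b : ℝ) ^ k⌋₊ + 1 + k)) j
    rwa [← Real.norm_eq_abs] at this) h2
  simpa using h3.add h1

theorem isLambdaPoissonGeneric_iff (d : ℕ → Fin b) {lam : ℝ} (hlam : 0 ≤ lam) :
    IsLambdaPoissonGeneric d lam ↔ ∀ j, Tendsto (fun k : ℕ =>
      hitProportion d (⌊lam * (b : ℝ) ^ k⌋₊ + 1) k j) atTop (𝓝 (poissonWeight lam j)) := by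
  simp only [IsLambdaPoissonGeneric, Z_eq_hitProportion d hlam, poissonWeight]

/-- Both the proportions, up to `1 / b ^ k`, and the limit are Lipschitz in `lam`. Hence countably
many parameters suffice, as the existence argument requires. -/
theorem isLambdaPoissonGeneric_of_rat (hb : 2 ≤ b) {d : ℕ → Fin b}
    (h : ∀ q : ℚ, 0 < q → IsLambdaPoissonGeneric d q) {lam : ℝ} (hlam : 0 < lam) :
    IsLambdaPoissonGeneric d lam := by
  have hb1 : (1 : ℝ) < b := by exact_mod_cast hb
  rw [isLambdaPoissonGeneric_iff d hlam.le]
  intro j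
  rw [Metric.tendsto_atTop]
  intro ε hε
  obtain ⟨q, hq1, hq2⟩ := exists_rat_btwn (show lam < lam + ε / 4 by linarith)
  have hq0 : (0 : ℝ) < q := hlam.trans hq1
  have hq := (isLambdaPoissonGeneric_iff d hq0.le).1 (h q (by exact_mod_cast hq0)) j
  rw [Metric.tendsto_atTop] at hq
  obtain ⟨K, hK⟩ := hq (ε / 4) (by linarith)
  have h0 := tendsto_one_div_pow hb
  obtain ⟨K', hK'⟩ := (Metric.tendsto_atTop.1 h0) (ε / 4) (by linarith)
  refine ⟨max K K', fun k hk => ?_⟩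
  have h1 := hK k (le_of_max_le_left hk)
  have h2 := hK' k (le_of_max_le_right hk)
  have hp : (0 : ℝ) < (b : ℝ) ^ k := by positivity
  have hmul : lam * (b : ℝ) ^ k ≤ q * (b : ℝ) ^ k := by gcongr
  have h3 := abs_hitProportion_sub_le_of_le d k j
    (Nat.add_le_add_right (Nat.floor_le_floor hmul) 1)
  have h4 := abs_poissonWeight_sub_le hlam.le hq0.le j
  rw [abs_of_pos (by linarith : (0 : ℝ) < q - lam)] at h4
  have h5 : (((⌊q * (b : ℝ) ^ k⌋₊ + 1 : ℕ) : ℝ) - (⌊lam * (b : ℝ) ^ k⌋₊ + 1 : ℕ)) / (b : ℝ) ^ k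
      ≤ (q - lam) + 1 / (b : ℝ) ^ k := by
    rw [div_le_iff₀ hp, add_mul, div_mul_cancel₀ _ hp.ne']
    have := Nat.floor_le (by positivity : 0 ≤ q * (b : ℝ) ^ k)
    have := Nat.lt_floor_add_one (lam * (b : ℝ) ^ k)
    push_cast
    linarith
  rw [Real.dist_eq] at *
  rw [sub_zero, abs_of_pos (by positivity)] at h2
  have h6 := h3.trans h5
  rw [abs_lt] at h1 ⊢
  rw [abs_le] at h4 h6
  constructor <;> linarith [h1.1, h1.2, h4.1, h4.2, h6.1, h6.2]

/-- Counts are monotone in the length and consecutive squares have ratio tending to `1`. Along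
squares the variance bounds become summable. -/
theorem isNormal_of_sq {d : ℕ → Fin b}
    (h : ∀ (k : ℕ) (w : Fin k → Fin b), Tendsto
      (fun m : ℕ => (hitCount d (m ^ 2 + 1 - k) w : ℝ) / ((m ^ 2 : ℕ) : ℝ)) atTop
        (𝓝 (1 / (b : ℝ) ^ k))) : IsNormal d := by
  intro k w
  refine tendsto_div_of_monotone_of_exists_subseq_tendsto_div (fun n => (W d n w : ℝ)) _ ?_ ?_
  · intro m n hmn
    simp only [W_eq_hitCount]
    exact_mod_cast hitCount_mono d (by omega) w
  · intro a ha
    refine ⟨fun m => m ^ 2, ?_, tendsto_pow_atTop two_ne_zero, ?_⟩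
    · have h1 : Tendsto (fun n : ℕ => ((1 : ℝ) + 1 / (n : ℝ)) ^ 2) atTop (𝓝 1) := by
        have := ((tendsto_one_div_atTop_nhds_zero_nat (𝕜 := ℝ)).const_add (1 : ℝ)).pow 2
        simpa using this
      filter_upwards [h1.eventually_lt_const ha, eventually_gt_atTop 0] with n hn hn0
      have hn0' : (0 : ℝ) < n := by exact_mod_cast hn0
      have e : (((n + 1) ^ 2 : ℕ) : ℝ) = (1 + 1 / (n : ℝ)) ^ 2 * ((n ^ 2 : ℕ) : ℝ) := by
        push_cast
        field_simp
      rw [e]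
      gcongr
    · simp only [W_eq_hitCount]
      exact h k w

theorem tendsto_expect_hitCount_sq [NeZero b] (k : ℕ) (w : Fin k → Fin b) :
    Tendsto (fun m : ℕ => expect (m ^ 2 + 1 - k + k)
      (fun d : ℕ → Fin b => (hitCount d (m ^ 2 + 1 - k) w : ℝ) / ((m ^ 2 : ℕ) : ℝ))) atTop
      (𝓝 (1 / (b : ℝ) ^ k)) := by
  have h0 : Tendsto (fun m : ℕ => (((m ^ 2 : ℕ) : ℝ))⁻¹) atTop (𝓝 0) :=
    tendsto_inv_atTop_zero.comp (tendsto_natCast_atTop_atTop.comp (tendsto_pow_atTop two_ne_zero))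
  have h1 : Tendsto (fun m : ℕ => (1 + (1 - (k : ℝ)) * (((m ^ 2 : ℕ) : ℝ))⁻¹) * (1 / (b : ℝ) ^ k))
      atTop (𝓝 (1 / (b : ℝ) ^ k)) := by
    simpa using ((h0.const_mul (1 - (k : ℝ))).const_add 1).mul_const (1 / (b : ℝ) ^ k)
  refine h1.congr' ?_
  filter_upwards [eventually_gt_atTop 0, eventually_ge_atTop k] with m hm hk
  have hmk : k ≤ m ^ 2 + 1 := by nlinarith
  have hm' : (((m ^ 2 : ℕ) : ℝ)) ≠ 0 := by positivity
  have e : (fun d : ℕ → Fin b => (hitCount d (m ^ 2 + 1 - k) w : ℝ) / ((m ^ 2 : ℕ) : ℝ))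
      = fun d => (((m ^ 2 : ℕ) : ℝ))⁻¹ * (hitCount d (m ^ 2 + 1 - k) w : ℝ) := by
    funext d; rw [div_eq_inv_mul]
  rw [e, expect_const_mul, expect_hitCount le_rfl, Nat.cast_sub hmk, Nat.cast_add, Nat.cast_one]
  field_simp
  ring

theorem summable_hitProportion_bound (hb : 2 ≤ b) {lam : ℝ} (hlam : 0 ≤ lam) :
    Summable fun k : ℕ => ((⌊lam * (b : ℝ) ^ k⌋₊ + 1 + k : ℕ) : ℝ)
      * (2 * k / (b : ℝ) ^ k) ^ 2 := by
  have hb1 : (1 : ℝ) < b := by exact_mod_cast hb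
  have hr : ‖(1 / (b : ℝ))‖ < 1 := by
    rw [Real.norm_eq_abs, abs_of_pos (by positivity), div_lt_one (by linarith)]
    exact hb1
  have h := ((summable_pow_mul_geometric_of_norm_lt_one 2 hr).mul_left (4 * (lam + 1))).add
    ((summable_pow_mul_geometric_of_norm_lt_one 3 hr).mul_left 4)
  refine Summable.of_nonneg_of_le (fun k => by positivity) (fun k => ?_) h
  have hp : (1 : ℝ) ≤ (b : ℝ) ^ k := one_le_pow₀ hb1.le
  have h1 : ((⌊lam * (b : ℝ) ^ k⌋₊ + 1 + k : ℕ) : ℝ) ≤ (lam + 1 + k) * (b : ℝ) ^ k := by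
    have := Nat.floor_le (by positivity : 0 ≤ lam * (b : ℝ) ^ k)
    have hk : (0 : ℝ) ≤ k := by positivity
    push_cast
    nlinarith
  calc _ ≤ (lam + 1 + k) * (b : ℝ) ^ k * (2 * k / (b : ℝ) ^ k) ^ 2 := by gcongr
    _ = _ := by
      rw [one_div, inv_pow]
      field_simp
      ring

theorem summable_hitCount_bound (k : ℕ) :
    Summable fun m : ℕ => ((m ^ 2 + 1 - k + k : ℕ) : ℝ) * ((k : ℝ) / ((m ^ 2 : ℕ) : ℝ)) ^ 2 := by
  have h := ((Real.summable_one_div_nat_pow (p := 2)).2 one_lt_two).mul_left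
    ((2 + (k : ℝ)) * (k : ℝ) ^ 2)
  refine Summable.of_nonneg_of_le (fun k => by positivity) (fun m => ?_) h
  -- At `m = 0` the quotient by zero is `0`, so this term vanishes.
  rcases Nat.eq_zero_or_pos m with rfl | hm
  · simp
  have h1 : m ^ 2 + 1 - k + k ≤ (2 + k) * m ^ 2 := by
    have : 1 ≤ m ^ 2 := Nat.one_le_pow _ _ hm
    have : k ≤ k * m ^ 2 := Nat.le_mul_of_pos_right _ this
    rw [add_mul]
    omega
  have h2 : ((m ^ 2 + 1 - k + k : ℕ) : ℝ) ≤ (2 + (k : ℝ)) * (m : ℝ) ^ 2 := by exact_mod_cast h1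
  have hm' : (0 : ℝ) < m := by exact_mod_cast hm
  calc _ ≤ ((2 + (k : ℝ)) * (m : ℝ) ^ 2) * ((k : ℝ) / ((m ^ 2 : ℕ) : ℝ)) ^ 2 := by gcongr
    _ = _ := by
      push_cast
      field_simp

/-- There is a sequence of digits that is both Poisson generic and normal. -/
theorem exists_poissonGeneric_isNormal (hb : 2 ≤ b) :
    ∃ d : ℕ → Fin b, (∀ lam : ℝ, 0 < lam → IsLambdaPoissonGeneric d lam) ∧ IsNormal d := by
  have : NeZero b := ⟨by omega⟩
  -- The left summand indexes Poisson conditions by a rational parameter and a count, the right one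
  -- normality conditions by a word.
  let ι := ({q : ℚ // 0 < q} × ℕ) ⊕ (Σ k : ℕ, (Fin k → Fin b))
  let F : ι → ℕ → (ℕ → Fin b) → ℝ := Sum.elim
    (fun p k d => hitProportion d (⌊((p.1 : ℚ) : ℝ) * (b : ℝ) ^ k⌋₊ + 1) k p.2)
    (fun p m d => (hitCount d (m ^ 2 + 1 - p.1) p.2 : ℝ) / ((m ^ 2 : ℕ) : ℝ))
  let n : ι → ℕ → ℕ := Sum.elim
    (fun p k => ⌊((p.1 : ℚ) : ℝ) * (b : ℝ) ^ k⌋₊ + 1 + k)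
    (fun p m => m ^ 2 + 1 - p.1 + p.1)
  let c : ι → ℕ → ℝ := Sum.elim
    (fun p k => 2 * k / (b : ℝ) ^ k) (fun p m => (p.1 : ℝ) / ((m ^ 2 : ℕ) : ℝ))
  obtain ⟨d, hd⟩ := exists_tendsto_sub_expect F n c
    (by rintro (p | p) m <;> simp only [c, Sum.elim_inl, Sum.elim_inr] <;> positivity)
    (by
      rintro (p | p) m x y h
      · exact dependsOn_hitProportion _ _ _ fun i hi => h i (by
          simp only [n, Sum.elim_inl, Set.mem_Iio] at hi ⊢
          omega)
      · simp only [F, Sum.elim_inr]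
        have := dependsOn_hitCount (m ^ 2 + 1 - p.1) p.2 fun i hi => h i (by
          simp only [n, Sum.elim_inr, Set.mem_Iio] at hi ⊢
          omega)
        simp only at this
        rw [this])
    (by
      rintro (p | p) m x i a
      · exact abs_hitProportion_update_sub_le _ _ _ _ _ _
      · simp only [F, c, Sum.elim_inr]
        rw [← sub_div, abs_div, Nat.abs_cast]
        gcongr
        exact abs_hitCount_update_sub_le _ _ _ _ _)
    (by
      rintro (p | p)
      · exact summable_hitProportion_bound hb (by exact_mod_cast p.1.2.le)
      · exact summable_hitCount_bound p.1)
  refine ⟨d, fun lam hlam => isLambdaPoissonGeneric_of_rat hb (fun q hq => ?_) hlam,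
    isNormal_of_sq fun k w => ?_⟩
  · have hq' : (0 : ℝ) ≤ q := by exact_mod_cast hq.le
    rw [isLambdaPoissonGeneric_iff d hq']
    intro j
    have h1 := (hd (Sum.inl (⟨q, hq⟩, j))).add (tendsto_expect_hitProportion hb hq' j)
    rw [zero_add] at h1
    exact h1.congr fun k => sub_add_cancel _ _
  · have h1 := (hd (Sum.inr ⟨k, w⟩)).add (tendsto_expect_hitCount_sq k w)
    rw [zero_add] at h1
    exact h1.congr fun k => sub_add_cancel _ _

end Existence

/-! ### A normal sequence that is not Poisson generic -/

section Sparse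

variable {b : ℕ}

theorem abs_hitCount_sub_le_card_ne (d e : ℕ → Fin b) (n : ℕ) {k : ℕ} (w : Fin k → Fin b) :
    |(hitCount d (n + 1 - k) w : ℝ) - hitCount e (n + 1 - k) w|
      ≤ k * ((Finset.range n).filter fun m => d m ≠ e m).card := by
  classical
  set S := (Finset.range n).filter fun m => d m ≠ e m with hS
  refine (abs_hitCount_sub_le (S.biUnion fun m => Finset.Ico (m + 1 - k) (m + 1)) ?_ w).trans ?_
  · intro i hi hT
    funext t
    by_contra hne
    refine hT (Finset.mem_biUnion.2 ⟨i + t, ?_, ?_⟩)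
    · rw [hS, Finset.mem_filter, Finset.mem_range]
      have := t.2
      exact ⟨by omega, hne⟩
    · rw [Finset.mem_Ico]
      have := t.2
      omega
  · have h := Finset.card_biUnion_le_card_mul S (fun m => Finset.Ico (m + 1 - k) (m + 1)) k
      (fun m _ => card_window_le m k)
    rw [mul_comm]
    exact_mod_cast h

/-- Changing the digits on a set of density zero preserves normality. -/
theorem IsNormal.of_density_zero {d e : ℕ → Fin b} (hd : IsNormal d)
    (h : Tendsto (fun n : ℕ => (((Finset.range n).filter fun m => d m ≠ e m).card : ℝ) / n) atTop
      (𝓝 0)) : IsNormal e := by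
  intro k w
  have h1 : Tendsto (fun n : ℕ => (W e n w : ℝ) / n - (W d n w : ℝ) / n) atTop (𝓝 0) := by
    refine squeeze_zero_norm (fun n => ?_) (by simpa using h.const_mul (k : ℝ))
    rw [← sub_div, norm_div, Real.norm_eq_abs, Real.norm_eq_abs, Nat.abs_cast, abs_sub_comm,
      ← mul_div_assoc, W_eq_hitCount, W_eq_hitCount]
    gcongr
    exact abs_hitCount_sub_le_card_ne d e n w
  simpa using h1.add (hd k w)

/-- The sequence obtained from `d` by writing `0` at the multiples of a slowly growing power
of `2`. -/
noncomputable def sparseZeros [NeZero b] (d : ℕ → Fin b) (n : ℕ) : Fin b :=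
  if 2 ^ Nat.log 4 (Nat.log b n) ∣ n then 0 else d n

variable [NeZero b]

/-- Beyond `b ^ 4 ^ A` the spacing is a power of `2` with exponent at least `A`, so every altered
position is a multiple of `2 ^ A`. The final `1` accounts for position `0`. -/
theorem card_sparseZeros_ne_le (hb : 2 ≤ b) (d : ℕ → Fin b) (A n : ℕ) :
    ((Finset.range n).filter fun m => d m ≠ sparseZeros d m).card
      ≤ b ^ 4 ^ A + (n / 2 ^ A + 1) := by
  classical
  have hsub : ((Finset.range n).filter fun m => d m ≠ sparseZeros d m)
      ⊆ Finset.range (b ^ 4 ^ A) ∪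
        (((Finset.range n.succ).filter fun m => m ≠ 0 ∧ 2 ^ A ∣ m) ∪ {0}) := by
    intro m hm
    rw [Finset.mem_filter, Finset.mem_range] at hm
    simp only [Finset.mem_union, Finset.mem_range, Finset.mem_filter, Finset.mem_singleton]
    by_cases h1 : m < b ^ 4 ^ A
    · exact Or.inl h1
    · right
      by_cases h0 : m = 0
      · exact Or.inr h0
      · refine Or.inl ⟨by omega, h0, ?_⟩
        have h2 : 2 ^ Nat.log 4 (Nat.log b m) ∣ m := by
          by_contra hcon
          exact hm.2 (by simp [sparseZeros, hcon])
        refine dvd_trans (pow_dvd_pow 2 ?_) h2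
        exact Nat.le_log_of_pow_le (by norm_num) (Nat.le_log_of_pow_le (by omega) (not_lt.1 h1))
  refine (Finset.card_le_card hsub).trans ((Finset.card_union_le _ _).trans ?_)
  rw [Finset.card_range]
  gcongr
  refine (Finset.card_union_le _ _).trans ?_
  rw [Nat.card_multiples', Finset.card_singleton]

theorem IsNormal.sparseZeros (hb : 2 ≤ b) {d : ℕ → Fin b} (hd : IsNormal d) :
    IsNormal (sparseZeros d) := by
  apply hd.of_density_zero
  rw [Metric.tendsto_atTop]
  intro ε hε
  obtain ⟨A, hA⟩ := exists_pow_lt_of_lt_one (half_pos hε) (by norm_num : (1 / 2 : ℝ) < 1)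
  obtain ⟨N, hN⟩ := exists_nat_gt (((b : ℝ) ^ 4 ^ A + 1) / (ε / 2))
  refine ⟨N + 1, fun n hn => ?_⟩
  have hn0 : (0 : ℝ) < n := by exact_mod_cast (by omega : 0 < n)
  have hNn : (N : ℝ) ≤ n := by exact_mod_cast (by omega : N ≤ n)
  rw [div_lt_iff₀ (half_pos hε)] at hN
  have h1 : (((Finset.range n).filter fun m => d m ≠ PoissonGeneric.sparseZeros d m).card : ℝ)
      ≤ (b : ℝ) ^ 4 ^ A + ((n / 2 ^ A : ℕ) + 1) := by
    exact_mod_cast card_sparseZeros_ne_le hb d A n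
  have h2 : ((n / 2 ^ A : ℕ) : ℝ) ≤ n * (1 / 2) ^ A := by
    refine Nat.cast_div_le.trans (le_of_eq ?_)
    push_cast
    rw [one_div_pow, mul_one_div]
  rw [Real.dist_eq, sub_zero, abs_of_nonneg (by positivity), div_lt_iff₀ hn0]
  nlinarith

/-- Since `g ^ 2 ≤ k`, each residue class modulo `g` contains at least `g` of the `k` positions, so
at least `g` letters are forced. -/
theorem card_filter_vanish_le {g k r : ℕ} (hr : r < g) (hg : g ^ 2 ≤ k) :
    (Finset.univ.filter fun w : Fin k → Fin b => ∀ t : Fin k, (t : ℕ) % g = r → w t = 0).card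
      ≤ b ^ (k - g) := by
  classical
  have hT : g ≤ (Finset.univ.filter fun t : Fin k => (t : ℕ) % g = r).card := by
    have hlt : ∀ s : Fin g, r + g * s < k := by
      intro s
      have := s.2
      nlinarith
    have h := Finset.card_le_card_of_injOn (s := (Finset.univ : Finset (Fin g)))
      (t := Finset.univ.filter fun t : Fin k => (t : ℕ) % g = r)
      (fun s => ⟨r + g * s, hlt s⟩)
      (fun s _ => by simp [Nat.mod_eq_of_lt hr])
      (fun s _ s' _ hss => by
        have h1 : r + g * (s : ℕ) = r + g * (s' : ℕ) := by simpa using congrArg Fin.val hss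
        exact Fin.ext (Nat.eq_of_mul_eq_mul_left (by omega) (Nat.add_left_cancel h1)))
    simpa using h
  have hsub : (Finset.univ.filter fun w : Fin k → Fin b =>
      ∀ t : Fin k, (t : ℕ) % g = r → w t = 0)
      ⊆ Fintype.piFinset fun t : Fin k => if (t : ℕ) % g = r then {0} else Finset.univ := by
    intro w hw
    rw [Finset.mem_filter] at hw
    rw [Fintype.mem_piFinset]
    intro t
    split_ifs with h
    · simpa using hw.2 t h
    · simp
  refine (Finset.card_le_card hsub).trans ?_
  rw [Fintype.card_piFinset]
  have h1 : ∀ t : Fin k, (if (t : ℕ) % g = r then ({0} : Finset (Fin b)) else Finset.univ).card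
      = if (t : ℕ) % g = r then 1 else b := by
    intro t; split_ifs <;> simp
  simp only [h1]
  rw [Finset.prod_ite, Finset.prod_const_one, one_mul, Finset.prod_const]
  apply Nat.pow_le_pow_right (NeZero.pos b)
  have h2 := Finset.card_filter_add_card_filter_not (s := (Finset.univ : Finset (Fin k)))
    (fun t : Fin k => (t : ℕ) % g = r)
  rw [Finset.card_univ, Fintype.card_fin] at h2
  omega

/-- Apart from words starting before `b ^ L` or near the end, every word read lies within the range
of positions whose base-`b` logarithm is `L`. There the zeros have constant spacing `g`, so the word
vanishes on a residue class modulo `g`; the last term counts such words over the `g` classes. -/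
theorem card_filter_hitCount_ne_zero_le (d : ℕ → Fin b) {L : ℕ}
    (hL : 0 < L) : (Finset.univ.filter fun w : Fin (L + 1) → Fin b =>
      hitCount (sparseZeros d) (b ^ (L + 1) + 1) w ≠ 0).card
      ≤ b ^ L + (L + 2) + 2 ^ Nat.log 4 L * b ^ (L + 1 - 2 ^ Nat.log 4 L) := by
  classical
  set e := sparseZeros d with he
  set g := 2 ^ Nat.log 4 L with hg
  have hg0 : 0 < g := by positivity
  -- The logarithm to base `4` makes `g ^ 2` a power of `4` not exceeding `L`.
  have hgL : g ^ 2 ≤ L := by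
    rw [hg, ← pow_mul, mul_comm, pow_mul]
    exact Nat.pow_log_le_self 4 (by omega)
  set A : ℕ → Finset (Fin (L + 1) → Fin b) := fun r =>
    Finset.univ.filter fun w => ∀ t : Fin (L + 1), (t : ℕ) % g = r → w t = 0 with hA
  have hsub : (Finset.univ.filter fun w : Fin (L + 1) → Fin b =>
      hitCount e (b ^ (L + 1) + 1) w ≠ 0)
      ⊆ ((Finset.range (b ^ L)).image (fun i => subword e i (L + 1))
        ∪ (Finset.Ico (b ^ (L + 1) + 1 - (L + 2)) (b ^ (L + 1) + 1)).image
          (fun i => subword e i (L + 1))) ∪ (Finset.range g).biUnion A := by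
    intro w hw
    rw [Finset.mem_filter, hitCount, Finset.card_ne_zero] at hw
    obtain ⟨i, hi⟩ := hw.2
    rw [Finset.mem_filter, Finset.mem_range] at hi
    simp only [Finset.mem_union, Finset.mem_image, Finset.mem_biUnion, Finset.mem_range,
      Finset.mem_Ico]
    by_cases h1 : i < b ^ L
    · exact Or.inl (Or.inl ⟨i, h1, hi.2⟩)
    by_cases h2 : b ^ (L + 1) + 1 - (L + 2) ≤ i
    · exact Or.inl (Or.inr ⟨i, ⟨h2, hi.1⟩, hi.2⟩)
    right
    -- This is the residue of `-i`: offsets `t` in this class are those with `g ∣ i + t`.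
    refine ⟨(g - i % g) % g, Nat.mod_lt _ hg0, ?_⟩
    rw [hA, Finset.mem_filter]
    refine ⟨Finset.mem_univ _, fun t ht => ?_⟩
    have htl := t.2
    have hlog : Nat.log b (i + t) = L :=
      (Nat.log_eq_iff (Or.inl hL.ne')).2 ⟨by omega, by omega⟩
    have hdvd : g ∣ i + t := by
      apply Nat.dvd_of_mod_eq_zero
      have him := Nat.mod_lt i hg0
      rw [Nat.add_mod, ht, Nat.add_mod_mod]
      rw [Nat.add_sub_cancel' him.le, Nat.mod_self]
    rw [← hi.2, subword, he, sparseZeros, hlog, if_pos hdvd]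
  refine (Finset.card_le_card hsub).trans ((Finset.card_union_le _ _).trans ?_)
  refine Nat.add_le_add ((Finset.card_union_le _ _).trans (Nat.add_le_add ?_ ?_)) ?_
  · exact Finset.card_image_le.trans (by simp)
  · exact Finset.card_image_le.trans (by rw [Nat.card_Ico]; omega)
  · refine (Finset.card_biUnion_le_card_mul _ _ (b ^ (L + 1 - g)) fun r hr => ?_).trans
      (by rw [Finset.card_range])
    exact card_filter_vanish_le (Finset.mem_range.1 hr) (by omega)

theorem le_hitProportion_zero {d : ℕ → Fin b} {N L g : ℕ} (hg : g ≤ L + 1)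
    (h : (Finset.univ.filter fun w : Fin (L + 1) → Fin b => hitCount d N w ≠ 0).card
      ≤ b ^ L + (L + 2) + g * b ^ (L + 1 - g)) :
    1 - 1 / (b : ℝ)
      - (((L + 1 : ℕ) : ℝ) * (1 / (b : ℝ) ^ (L + 1)) + 1 / (b : ℝ) ^ (L + 1))
      - (g : ℝ) * (1 / (b : ℝ) ^ g) ≤ hitProportion d N (L + 1) 0 := by
  have hb0 : (0 : ℝ) < b := by exact_mod_cast NeZero.pos b
  have hp : (0 : ℝ) < (b : ℝ) ^ (L + 1) := by positivity
  have hsum := Finset.card_filter_add_card_filter_not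
    (s := (Finset.univ : Finset (Fin (L + 1) → Fin b))) (fun w => hitCount d N w = 0)
  rw [Finset.card_univ, Fintype.card_fun, Fintype.card_fin, Fintype.card_fin] at hsum
  rw [hitProportion, le_div_iff₀ hp]
  set X := (Finset.univ.filter fun w : Fin (L + 1) → Fin b => hitCount d N w = 0).card
  have hle : b ^ (L + 1) ≤ X + (b ^ L + (L + 2) + g * b ^ (L + 1 - g)) := by
    rw [← hsum]
    exact Nat.add_le_add_left h _
  have hle' : (b : ℝ) ^ (L + 1) ≤ X + ((b : ℝ) ^ L + (L + 2) + g * (b : ℝ) ^ (L + 1 - g)) := by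
    exact_mod_cast hle
  have e1 : (b : ℝ) ^ (L + 1 - g) = (b : ℝ) ^ (L + 1) * (1 / (b : ℝ) ^ g) := by
    rw [pow_sub₀ _ hb0.ne' hg, one_div]
  have e2 : (b : ℝ) ^ L = (b : ℝ) ^ (L + 1) * (1 / b) := by
    rw [pow_succ]
    field_simp
  have e3 : (b : ℝ) ^ (L + 1) * (1 / (b : ℝ) ^ (L + 1)) = 1 := mul_one_div_cancel hp.ne'
  rw [e1, e2] at hle'
  push_cast
  linear_combination hle' - ((L : ℝ) + 2) * e3

theorem not_isLambdaPoissonGeneric_sparseZeros (hb : 2 ≤ b) (d : ℕ → Fin b) :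
    ¬ IsLambdaPoissonGeneric (sparseZeros d) 1 := by
  intro h
  have hb2 : (2 : ℝ) ≤ b := by exact_mod_cast hb
  have h1 := ((isLambdaPoissonGeneric_iff _ zero_le_one).1 h 0).comp (tendsto_add_atTop_nat 1)
  have hlog : Tendsto (fun L : ℕ => 2 ^ Nat.log 4 L) atTop atTop := by
    refine (tendsto_pow_atTop_atTop_of_one_lt one_lt_two).comp ?_
    rw [tendsto_atTop]
    intro A
    filter_upwards [eventually_ge_atTop (4 ^ A)] with L hL
    exact Nat.le_log_of_pow_le (by norm_num) hL
  have h2 := (tendsto_mul_one_div_pow hb).comp hlog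
  have h3 := ((tendsto_mul_one_div_pow hb).add (tendsto_one_div_pow hb)).comp
    (tendsto_add_atTop_nat 1)
  have h4 : Tendsto (fun L : ℕ => 1 - 1 / (b : ℝ)
      - (((L + 1 : ℕ) : ℝ) * (1 / (b : ℝ) ^ (L + 1)) + 1 / (b : ℝ) ^ (L + 1))
      - ((2 ^ Nat.log 4 L : ℕ) : ℝ) * (1 / (b : ℝ) ^ 2 ^ Nat.log 4 L)) atTop
      (𝓝 (1 - 1 / (b : ℝ))) := by
    simpa [Function.comp_def] using (h3.const_sub (1 - 1 / (b : ℝ))).sub h2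
  have h5 : 1 - 1 / (b : ℝ) ≤ poissonWeight 1 0 := by
    refine le_of_tendsto_of_tendsto h4 h1 ?_
    filter_upwards [eventually_gt_atTop 0] with L hL
    have hfl : ⌊(1 : ℝ) * (b : ℝ) ^ (L + 1)⌋₊ = b ^ (L + 1) := by
      rw [one_mul, ← Nat.cast_pow, Nat.floor_natCast]
    simp only [Function.comp_apply, hfl]
    refine le_hitProportion_zero ?_ (card_filter_hitCount_ne_zero_le d hL)
    exact (Nat.pow_le_pow_left (by norm_num : 2 ≤ 4) _).trans
      ((Nat.pow_log_le_self 4 hL.ne').trans (Nat.le_succ L))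
  -- The Poisson value is `exp (-1)`, and `exp 1 > 2`.
  have h6 : poissonWeight 1 0 < 1 / 2 := by
    have h7 : (2 : ℝ) < Real.exp 1 := by linarith [Real.exp_one_gt_d9]
    simp only [poissonWeight, Real.exp_neg]
    norm_num
    exact (inv_lt_inv₀ (by positivity) (by norm_num)).2 h7 |>.trans_eq (by norm_num)
  have h8 : 1 / (b : ℝ) ≤ 1 / 2 := by gcongr
  linarith

end Sparse

/-! ### Existence and uniqueness of base-`b` expansions -/

section Expansion

variable {b : ℕ}

theorem hasSum_sub_one_div_pow (hb : 2 ≤ b) :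
    HasSum (fun j : ℕ => ((b : ℝ) - 1) / (b : ℝ) ^ (j + 1)) 1 := by
  have hb1 : (1 : ℝ) < b := by exact_mod_cast hb
  have h := (hasSum_geometric_of_lt_one (by positivity : (0 : ℝ) ≤ 1 / b)
    (by rw [div_lt_one (by linarith)]; exact hb1)).mul_left (((b : ℝ) - 1) / b)
  have hb0 : (b : ℝ) - 1 ≠ 0 := by linarith
  have e1 : ((b : ℝ) - 1) / b * (1 - 1 / (b : ℝ))⁻¹ = 1 := by
    have : (b : ℝ) ≠ 0 := by linarith
    field_simp
  have e2 : (fun j : ℕ => ((b : ℝ) - 1) / (b : ℝ) ^ (j + 1))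
      = fun j => ((b : ℝ) - 1) / b * (1 / (b : ℝ)) ^ j := by
    funext j
    rw [one_div_pow, pow_succ]
    field_simp
  rw [e1] at h
  rwa [e2]

theorem digit_div_le (d : ℕ → Fin b) (j : ℕ) :
    ((d j : ℕ) : ℝ) / (b : ℝ) ^ (j + 1) ≤ ((b : ℝ) - 1) / (b : ℝ) ^ (j + 1) := by
  have h : ((d j : ℕ) : ℝ) + 1 ≤ b := by exact_mod_cast (d j).2
  gcongr
  linarith

theorem exists_isExpansion (hb : 2 ≤ b) {d : ℕ → Fin b} (h : {j | (d j : ℕ) ≠ 0}.Infinite)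
    (h0 : ∃ j, (d j : ℕ) = 0) : ∃ x ∈ Set.Ico (0 : ℝ) 1, IsExpansion b x d := by
  have hb1 : (1 : ℝ) < b := by exact_mod_cast hb
  have hs := hasSum_sub_one_div_pow hb
  have hd : Summable fun j : ℕ => ((d j : ℕ) : ℝ) / (b : ℝ) ^ (j + 1) :=
    Summable.of_nonneg_of_le (fun j => by positivity) (digit_div_le d) hs.summable
  refine ⟨_, ⟨tsum_nonneg fun j => by positivity, ?_⟩, hd.hasSum, h⟩
  obtain ⟨j, hj⟩ := h0
  refine hasSum_lt (digit_div_le d) (i := j) ?_ hd.hasSum hs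
  rw [hj, Nat.cast_zero, zero_div]
  exact div_pos (by linarith) (by positivity)

/-- If `e` is larger at the first difference, its excess of at least one unit there can be offset
only if all later digits of `e` are `0` and those of `d` are `b - 1`. Infinitely many nonzero digits
in `e` forbid this. -/
theorem IsExpansion.not_lt_of_agree {x : ℝ} {d e : ℕ → Fin b} (hb : 2 ≤ b)
    (hd : IsExpansion b x d) (he : IsExpansion b x e) {m : ℕ} (hm : ∀ j < m, d j = e j) :
    ¬ (d m : ℕ) < e m := by
  intro hlt
  have hb1 : (1 : ℝ) < b := by exact_mod_cast hb
  have hu : HasSum (fun j : ℕ => ((e j : ℕ) : ℝ) / (b : ℝ) ^ (j + 1)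
      - ((d j : ℕ) : ℝ) / (b : ℝ) ^ (j + 1)) 0 := by
    simpa using he.1.sub hd.1
  -- The differences of `c` are the smallest possible differences of the two expansions: `0` before
  -- `m`, one unit at `m`, and `-(b - 1)` units afterwards. They telescope to total `0`.
  set c : ℕ → ℝ := fun j => if j ≤ m then 0 else -(1 / (b : ℝ) ^ j) with hc
  have hvm : ∀ j > m, c j - c (j + 1) = -(((b : ℝ) - 1) / (b : ℝ) ^ (j + 1)) := by
    intro j hj
    simp only [hc, if_neg (by omega : ¬ j ≤ m), if_neg (by omega : ¬ j + 1 ≤ m)]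
    field_simp
    ring
  have hv0 : ∀ j < m, c j - c (j + 1) = 0 := by
    intro j hj
    simp only [hc, if_pos hj.le, if_pos (by omega : j + 1 ≤ m), sub_zero]
  have hv1 : c m - c (m + 1) = 1 / (b : ℝ) ^ (m + 1) := by
    simp [hc]
  have hv : HasSum (fun j => c j - c (j + 1)) 0 := by
    have hsum : Summable fun j => c j - c (j + 1) := by
      refine Summable.of_norm_bounded (hasSum_sub_one_div_pow hb).summable fun j => ?_
      have hnn : (0 : ℝ) ≤ ((b : ℝ) - 1) / (b : ℝ) ^ (j + 1) :=
        div_nonneg (by linarith) (by positivity)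
      rcases lt_trichotomy j m with h | h | h
      · rw [hv0 j h, norm_zero]
        exact hnn
      · subst h
        rw [hv1, Real.norm_eq_abs, abs_of_nonneg (by positivity)]
        have : (2 : ℝ) ≤ b := by exact_mod_cast hb
        gcongr
        linarith
      · rw [hvm j h, norm_neg, Real.norm_eq_abs, abs_of_nonneg hnn]
    rw [hsum.hasSum_iff_tendsto_nat]
    have h1 : ∀ n, ∑ j ∈ Finset.range n, (c j - c (j + 1)) = - c n := by
      intro n
      rw [Finset.sum_range_sub']
      simp [hc]
    simp only [h1]
    refine (tendsto_one_div_pow hb).congr' ?_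
    filter_upwards [eventually_gt_atTop m] with n hn
    simp only [hc, if_neg (by omega : ¬ n ≤ m), neg_neg]
  have hle : ∀ j, c j - c (j + 1) ≤ ((e j : ℕ) : ℝ) / (b : ℝ) ^ (j + 1)
      - ((d j : ℕ) : ℝ) / (b : ℝ) ^ (j + 1) := by
    intro j
    rcases lt_trichotomy j m with h | h | h
    · rw [hv0 j h, hm j h, sub_self]
    · subst h
      rw [hv1, ← sub_div]
      have : ((d j : ℕ) : ℝ) + 1 ≤ (e j : ℕ) := by exact_mod_cast hlt
      gcongr
      linarith
    · rw [hvm j h]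
      have h1 := digit_div_le d j
      have h2 : (0 : ℝ) ≤ ((e j : ℕ) : ℝ) / (b : ℝ) ^ (j + 1) := by positivity
      linarith
  obtain ⟨j, hj, hjm⟩ := he.2.exists_gt m
  refine lt_irrefl (0 : ℝ) (hasSum_lt hle (i := j) ?_ hv hu)
  rw [hvm j hjm]
  have h1 := digit_div_le d j
  have hj' : (0 : ℝ) < (e j : ℕ) := by exact_mod_cast Nat.pos_of_ne_zero hj
  have h2 : (0 : ℝ) < ((e j : ℕ) : ℝ) / (b : ℝ) ^ (j + 1) := by positivity
  linarith

theorem IsExpansion.unique {x : ℝ} {d e : ℕ → Fin b} (hb : 2 ≤ b) (hd : IsExpansion b x d)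
    (he : IsExpansion b x e) : d = e := by
  funext m
  induction m using Nat.strong_induction_on with
  | _ m ih =>
    have h1 := hd.not_lt_of_agree hb he ih
    have h2 := he.not_lt_of_agree hb hd fun j hj => (ih j hj).symm
    exact Fin.ext (by omega)

theorem IsNormal.infinite_digit {d : ℕ → Fin b} (hb : 2 ≤ b) (hd : IsNormal d) (a : Fin b) :
    {j | d j = a}.Infinite := by
  intro hfin
  have h1 := hd 1 fun _ => a
  have h2 : Tendsto (fun n : ℕ => (W d n (fun _ : Fin 1 => a) : ℝ) / n) atTop (𝓝 0) := by
    refine squeeze_zero (fun n => by positivity) (fun n => ?_)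
      (tendsto_const_div_atTop_nhds_zero_nat (hfin.toFinset.card : ℝ))
    gcongr
    rw [W_eq_hitCount]
    apply Finset.card_le_card
    intro i hi
    rw [Finset.mem_filter] at hi
    rw [Set.Finite.mem_toFinset]
    simpa [subword] using congrFun hi.2 0
  have h3 := tendsto_nhds_unique h1 h2
  have hb0 : (0 : ℝ) < 1 / (b : ℝ) ^ 1 := by positivity
  linarith

theorem IsNormal.exists_isExpansion {d : ℕ → Fin b} (hb : 2 ≤ b) (hd : IsNormal d) :
    ∃ x ∈ Set.Ico (0 : ℝ) 1, IsExpansion b x d := by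
  apply PoissonGeneric.exists_isExpansion hb
  · refine (hd.infinite_digit hb ⟨1, hb⟩).mono fun j hj => ?_
    rw [Set.mem_ofPred_eq] at hj ⊢
    simp [hj]
  · obtain ⟨j, hj⟩ := (hd.infinite_digit hb ⟨0, by omega⟩).nonempty
    rw [Set.mem_ofPred_eq] at hj
    exact ⟨j, by simp [hj]⟩

end Expansion

/-! ### Invariance under finite changes, and closedness -/

section Tail

variable {b : ℕ}

/-- Only words starting before `m` can differ, which affects at most `2 * m` of the `b ^ k` words.
-/
theorem IsLambdaPoissonGeneric.congr_tail {d e : ℕ → Fin b} (hb : 2 ≤ b) {m : ℕ}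
    (h : ∀ i ≥ m, d i = e i) {lam : ℝ} (hlam : 0 ≤ lam) (hd : IsLambdaPoissonGeneric d lam) :
    IsLambdaPoissonGeneric e lam := by
  rw [isLambdaPoissonGeneric_iff _ hlam] at hd ⊢
  intro j
  have h1 : Tendsto (fun k : ℕ => hitProportion e (⌊lam * (b : ℝ) ^ k⌋₊ + 1) k j
      - hitProportion d (⌊lam * (b : ℝ) ^ k⌋₊ + 1) k j) atTop (𝓝 0) := by
    refine squeeze_zero_norm (a := fun k : ℕ => 2 * (m : ℝ) * (1 / (b : ℝ) ^ k)) (fun k => ?_)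
      (by simpa using (tendsto_one_div_pow hb).const_mul (2 * (m : ℝ)))
    have := abs_hitProportion_sub_le_of_eqOn (d := e) (e := d) (N := ⌊lam * (b : ℝ) ^ k⌋₊ + 1)
      (k := k) j (Finset.range m) (fun i _ hi => by
        funext t
        rw [Finset.mem_range] at hi
        exact (h (i + t) (by omega)).symm)
    rwa [Finset.card_range, ← mul_one_div] at this
  simpa using h1.add (hd j)

theorem IsNormal.congr_tail {d e : ℕ → Fin b} {m : ℕ} (h : ∀ i ≥ m, d i = e i)
    (hd : IsNormal d) : IsNormal e := by
  apply hd.of_density_zero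
  refine squeeze_zero (fun n => by positivity) (fun n => ?_)
    (tendsto_const_div_atTop_nhds_zero_nat (m : ℝ))
  gcongr
  have h1 : ((Finset.range n).filter fun i => d i ≠ e i) ⊆ Finset.range m := by
    intro i hi
    rw [Finset.mem_filter] at hi
    rw [Finset.mem_range]
    by_contra hlt
    exact hi.2 (h i (by omega))
  exact (Finset.card_le_card h1).trans_eq (Finset.card_range m)

theorem isClosed_hasLargeDiscrepancy (f : (k : ℕ) → (Fin k → Fin b) → ℕ → ℝ) :
    IsClosed {d : ℕ → Fin b | HasLargeDiscrepancy f d} := by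
  simp only [HasLargeDiscrepancy, Set.ofPred_forall]
  refine isClosed_iInter fun k => isClosed_iInter fun w => isClosed_iInter fun n =>
    isClosed_iInter fun _ => ?_
  have h : DependsOn (fun d : ℕ → Fin b => discrepancy d w n) (Set.Iio (n + 1 - k + k - 1)) := by
    intro d e hde
    have h1 : hitCount d (n + 1 - k) w = hitCount e (n + 1 - k) w := dependsOn_hitCount _ w hde
    simp only [discrepancy, W_eq_hitCount, h1]
  -- Local constancy makes every preimage open, in particular that of the complement of the strict
  -- inequality.
  exact ⟨isLocallyConstant_of_dependsOn h {y | f k w n < y}ᶜ⟩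

end Tail

end PoissonGeneric

/-! ### The density argument -/

theorem mainTheorem6 (b : ℕ) (hb : 2 ≤ b) (f : (k : ℕ) → (Fin k → Fin b) → ℕ → ℝ) :
    IsClosed {d : ℕ → Fin b | PoissonGeneric.HasLargeDiscrepancy f d} ∧
      PoissonGeneric.poissonGenericReals b ≠
        {x : ℝ | x ∈ PoissonGeneric.normalReals b ∧
          x ∈ PoissonGeneric.largeDiscrepancyReals b f} := by
  have hclosed := PoissonGeneric.isClosed_hasLargeDiscrepancy f
  refine ⟨hclosed, fun heq => ?_⟩
  have : NeZero b := ⟨by omega⟩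
  obtain ⟨p, hpP, hpN⟩ := PoissonGeneric.exists_poissonGeneric_isNormal hb
  have hall : ∀ d : ℕ → Fin b, PoissonGeneric.HasLargeDiscrepancy f d := by
    intro d
    -- Splicing initial segments of `d` onto the tail of `p` gives Poisson generic sequences
    -- converging to `d`.
    set u : ℕ → ℕ → Fin b := fun m i => if i < m then d i else p i with hu
    have hut : Tendsto u atTop (𝓝 d) := by
      rw [tendsto_pi_nhds]
      intro i
      refine tendsto_const_nhds.congr' ?_
      filter_upwards [eventually_gt_atTop i] with m hm
      simp [hu, hm]
    refine hclosed.mem_of_tendsto hut (Eventually.of_forall fun m => ?_)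
    have hagree : ∀ i ≥ m, p i = u m i := fun i hi => by
      simp [hu, not_lt.2 hi]
    obtain ⟨x, hx, hxu⟩ := (hpN.congr_tail hagree).exists_isExpansion hb
    have hxP : x ∈ PoissonGeneric.poissonGenericReals b :=
      ⟨hx, u m, hxu, fun lam hlam => (hpP lam hlam).congr_tail hb hagree hlam.le⟩
    rw [heq] at hxP
    obtain ⟨-, -, e, he, heD⟩ := hxP
    -- Membership of the real `x` only provides some expansion; uniqueness identifies it with `u m`.
    rw [he.unique hb hxu] at heD
    exact heD
  obtain ⟨x, hx, hxq⟩ := (hpN.sparseZeros hb).exists_isExpansion hb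
  have hxP : x ∈ PoissonGeneric.poissonGenericReals b := by
    rw [heq]
    exact ⟨⟨hx, _, hxq, hpN.sparseZeros hb⟩, hx, _, hxq, hall _⟩
  obtain ⟨-, e, he, heP⟩ := hxP
  rw [he.unique hb hxq] at heP
  exact PoissonGeneric.not_isLambdaPoissonGeneric_sparseZeros hb p (heP 1 one_pos)
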